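/- For $j\in\{1,2\}$ let $(M_j,\omega_j)$ be a compact connected Kähler manifold of complex dimension $d_j\ge 1$, and let $(L_j,h_j)\to M_j$ be a holomorphic hermitian line bundle which is very ample and whose Chern connection has curvature $-i\omega_j$. Let $L_1\boxtimes L_2=\pi_1^*L_1\otimes\pi_2^*L_2\to M_1\times M_2$ carry the hermitian metric $h=h_1\otimes h_2$, and let $\mathcal H=H^0(M_1\times M_2,L_1\boxtimes L_2)\cong H^0(M_1,L_1)\otimes H^0(M_2,L_2)$ be the finite-dimensional Hilbert space of global holomorphic sections, with inner product $\langle s,t\rangle=\int h(s,t)\,d\mu$, where $\mu$ is the measure associated to the volume form $\frac{\omega_1^{d_1}\omega_2^{d_2}}{d_1!\,d_2!}$ (equivalently, the tensor product of the $L^2$ inner products of the two factors). For an orthonormal basis $(\theta_j)$ of $\mathcal H$, a point $x\in M_1\times M_2$ and an identification of the fibre of $\overline{L_1\boxtimes L_2}$ at $x$ with $\mathbb C$ given by a nonzero vector of the fibre of $L_1\boxtimes L_2$ at $x$, put $\Phi_x=\sum_j\overline{\theta_j(x)}\otimes\theta_j\in\mathcal H$. The coherent state at $x$ is $|x\rangle=\Phi_x/\|\Phi_x\|$,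 which is well defined up to a phase. The covariant symbol of a linear operator $\sigma$ on $\mathcal H$ is $\hat\sigma(x)=\langle x|\sigma|x\rangle$. For a subset $\Lambda\subset M_1\times M_2$ let $\mathcal R_\Lambda$ be the map $s\mapsto s|_\Lambda$ on $\mathcal H$, let $\Pi_\Lambda^{\ker}$ be the orthogonal projection of $\mathcal H$ onto $\ker\mathcal R_\Lambda$, and let $\rho_\Lambda^{\ker}=\Pi_\Lambda^{\ker}/\operatorname{tr}(\Pi_\Lambda^{\ker})$ if this trace is nonzero, and $\rho_\Lambda^{\ker}=0$ otherwise. Let $\sigma$ be a mixed state on $\mathcal H$ (a hermitian positive semidefinite operator of trace $1$) which is a normalized orthogonal projection, that is, $\sigma=\Pi/\operatorname{tr}(\Pi)$ for the orthogonal projection $\Pi$ onto a subspace of $\mathcal H$. Suppose that $\operatorname{Ran}(\sigma)^\perp$ has a basis consisting of coherent states, and let $\mathcal V(\sigma)=\{x\in M_1\times M_2:\hat\sigma(x)=0\}$. Then $\rho^{\ker}_{\mathcal V(\sigma)}=\sigma$. -/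

import Mathlib

set_option linter.unusedSectionVars false

open Bundle Set MeasureTheory
open scoped Manifold ContDiff Topology TensorProduct

noncomputable section

namespace KahlerQuantization

section ExternalTensorProduct

variable {B₁ B₂ : Type*}

/-- The fibres of the external tensor product `L₁ ⊠ L₂ = π₁^* L₁ ⊗ π₂^* L₂`. -/
def ExtTensor (L₁ : B₁ → Type*) (L₂ : B₂ → Type*)
    [∀ x, NormedAddCommGroup (L₁ x)] [∀ x, InnerProductSpace ℂ (L₁ x)]
    [∀ y, NormedAddCommGroup (L₂ y)] [∀ y, InnerProductSpace ℂ (L₂ y)] (p : B₁ × B₂) : Type _ :=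
  L₁ p.1 ⊗[ℂ] L₂ p.2

variable {L₁ : B₁ → Type*} {L₂ : B₂ → Type*}
  [∀ x, NormedAddCommGroup (L₁ x)] [∀ x, InnerProductSpace ℂ (L₁ x)]
  [∀ y, NormedAddCommGroup (L₂ y)] [∀ y, InnerProductSpace ℂ (L₂ y)]

instance instNormedAddCommGroupExtTensor (p : B₁ × B₂) :
    NormedAddCommGroup (ExtTensor L₁ L₂ p) :=
  inferInstanceAs (NormedAddCommGroup (L₁ p.1 ⊗[ℂ] L₂ p.2))

/-- The tensor product hermitian metric, determined by
`⟪a ⊗ b, a' ⊗ b'⟫ = ⟪a, a'⟫ * ⟪b, b'⟫`. -/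
instance instInnerProductSpaceExtTensor (p : B₁ × B₂) :
    InnerProductSpace ℂ (ExtTensor L₁ L₂ p) :=
  inferInstanceAs (InnerProductSpace ℂ (L₁ p.1 ⊗[ℂ] L₂ p.2))

/-- The pure tensor `a ⊗ b` as an element of the fibre of `L₁ ⊠ L₂`. -/
def pureTensor {x : B₁} {y : B₂} (a : L₁ x) (b : L₂ y) : ExtTensor L₁ L₂ (x, y) := a ⊗ₜ[ℂ] b

variable [TopologicalSpace B₁] [TopologicalSpace B₂]
  [TopologicalSpace (TotalSpace ℂ L₁)] [TopologicalSpace (TotalSpace ℂ L₂)]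
  [FiberBundle ℂ L₁] [FiberBundle ℂ L₂] [VectorBundle ℂ ℂ L₁] [VectorBundle ℂ ℂ L₂]

/-- The fibre coordinate of `L₁ ⊠ L₂` induced by local trivializations of `L₁` and `L₂`:
`a ⊗ b ↦ e₁ a * e₂ b`. -/
def extCoord (e₁ : Trivialization ℂ (π ℂ L₁)) (e₂ : Trivialization ℂ (π ℂ L₂))
    [e₁.IsLinear ℂ] [e₂.IsLinear ℂ] (p : B₁ × B₂) : ExtTensor L₁ L₂ p →ₗ[ℂ] ℂ :=
  (TensorProduct.lid ℂ ℂ).toLinearMap ∘ₗ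
    TensorProduct.map (e₁.linearMapAt ℂ p.1) (e₂.linearMapAt ℂ p.2)

/-- The local frame `e₁⁻¹(1) ⊗ e₂⁻¹(1)` of `L₁ ⊠ L₂`. -/
def extFrame (e₁ : Trivialization ℂ (π ℂ L₁)) (e₂ : Trivialization ℂ (π ℂ L₂))
    (p : B₁ × B₂) : ExtTensor L₁ L₂ p :=
  e₁.symm p.1 1 ⊗ₜ[ℂ] e₂.symm p.2 1

theorem symm_eq_smul {B : Type*} {L : B → Type*} [∀ x, NormedAddCommGroup (L x)]
    [∀ x, InnerProductSpace ℂ (L x)] [TopologicalSpace B] [TopologicalSpace (TotalSpace ℂ L)]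
    [FiberBundle ℂ L] [VectorBundle ℂ ℂ L] (e : Trivialization ℂ (π ℂ L)) [e.IsLinear ℂ] {x : B}
    (hx : x ∈ e.baseSet) (c : ℂ) : e.symm x c = c • e.symm x 1 := by
  rw [← e.coe_symmₗ (R := ℂ) hx, ← map_smul, smul_eq_mul, mul_one]

theorem extCoord_extFrame (e₁ : Trivialization ℂ (π ℂ L₁)) (e₂ : Trivialization ℂ (π ℂ L₂))
    [e₁.IsLinear ℂ] [e₂.IsLinear ℂ] {p : B₁ × B₂} (h₁ : p.1 ∈ e₁.baseSet) (h₂ : p.2 ∈ e₂.baseSet) :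
    extCoord e₁ e₂ p (extFrame e₁ e₂ p) = 1 := by
  have h := e₁.linearMapAt_symm h₁ (R := ℂ) 1
  have h' := e₂.linearMapAt_symm h₂ (R := ℂ) 1
  change (TensorProduct.lid ℂ ℂ) (TensorProduct.map (e₁.linearMapAt ℂ p.1) (e₂.linearMapAt ℂ p.2)
    (e₁.symm p.1 1 ⊗ₜ[ℂ] e₂.symm p.2 1)) = 1
  rw [TensorProduct.map_tmul, h, h']
  simp

theorem extCoord_smul_extFrame (e₁ : Trivialization ℂ (π ℂ L₁)) (e₂ : Trivialization ℂ (π ℂ L₂))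
    [e₁.IsLinear ℂ] [e₂.IsLinear ℂ] {p : B₁ × B₂} (h₁ : p.1 ∈ e₁.baseSet) (h₂ : p.2 ∈ e₂.baseSet)
    (u : ExtTensor L₁ L₂ p) : extCoord e₁ e₂ p u • extFrame e₁ e₂ p = u := by
  have key : (LinearMap.toSpanSingleton ℂ _ (extFrame e₁ e₂ p)) ∘ₗ extCoord e₁ e₂ p
      = LinearMap.id := by
    refine TensorProduct.ext' fun a b ↦ ?_
    change (TensorProduct.lid ℂ ℂ) (TensorProduct.map (e₁.linearMapAt ℂ p.1)
      (e₂.linearMapAt ℂ p.2) (a ⊗ₜ[ℂ] b)) • (e₁.symm p.1 1 ⊗ₜ[ℂ] e₂.symm p.2 1) = a ⊗ₜ[ℂ] b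
    rw [TensorProduct.map_tmul, TensorProduct.lid_tmul, smul_eq_mul,
      ← TensorProduct.smul_tmul_smul, ← symm_eq_smul e₁ h₁, ← symm_eq_smul e₂ h₂,
      e₁.symm_linearMapAt h₁, e₂.symm_linearMapAt h₂]
  exact LinearMap.congr_fun key u

open Classical in
/-- The local trivialization `e₁ ⊗ e₂` of `L₁ ⊠ L₂`, over `U₁ × U₂`. -/
def extPretrivialization (e₁ : Trivialization ℂ (π ℂ L₁)) (e₂ : Trivialization ℂ (π ℂ L₂))
    [e₁.IsLinear ℂ] [e₂.IsLinear ℂ] : Pretrivialization ℂ (π ℂ (ExtTensor L₁ L₂)) where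
  toFun u := (u.1, extCoord e₁ e₂ u.1 u.2)
  invFun q := ⟨q.1, q.2 • extFrame e₁ e₂ q.1⟩
  source := π ℂ (ExtTensor L₁ L₂) ⁻¹' (e₁.baseSet ×ˢ e₂.baseSet)
  target := (e₁.baseSet ×ˢ e₂.baseSet) ×ˢ univ
  map_source' := fun u hu ↦ ⟨hu, mem_univ _⟩
  map_target' := fun q hq ↦ hq.1
  left_inv' := by
    rintro ⟨p, u⟩ hu
    exact congrArg (TotalSpace.mk p) (extCoord_smul_extFrame e₁ e₂ hu.1 hu.2 u)
  right_inv' := by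
    rintro ⟨p, c⟩ hp
    refine Prod.ext rfl ?_
    change extCoord e₁ e₂ p (c • extFrame e₁ e₂ p) = c
    rw [map_smul, extCoord_extFrame e₁ e₂ hp.1.1 hp.1.2, smul_eq_mul, mul_one]
  open_target := (e₁.open_baseSet.prod e₂.open_baseSet).prod isOpen_univ
  baseSet := e₁.baseSet ×ˢ e₂.baseSet
  open_baseSet := e₁.open_baseSet.prod e₂.open_baseSet
  source_eq := rfl
  target_eq := rfl
  proj_toFun := fun _ _ ↦ rfl

instance extPretrivialization.isLinear (e₁ : Trivialization ℂ (π ℂ L₁))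
    (e₂ : Trivialization ℂ (π ℂ L₂)) [e₁.IsLinear ℂ] [e₂.IsLinear ℂ] :
    (extPretrivialization e₁ e₂).IsLinear ℂ where
  linear p _ := ⟨(extCoord e₁ e₂ p).map_add, (extCoord e₁ e₂ p).map_smul⟩

theorem extPretrivialization_symm_apply (e₁ : Trivialization ℂ (π ℂ L₁))
    (e₂ : Trivialization ℂ (π ℂ L₂)) [e₁.IsLinear ℂ] [e₂.IsLinear ℂ] {p : B₁ × B₂}
    (hp : p ∈ e₁.baseSet ×ˢ e₂.baseSet) (c : ℂ) :
    (extPretrivialization e₁ e₂).symm p c = c • extFrame e₁ e₂ p := by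
  rw [Pretrivialization.symm_apply _ (show p ∈ (extPretrivialization e₁ e₂).baseSet from hp)]
  rfl

/-- The coordinate change between two of these trivializations is the product of the coordinate
changes of the factors. -/
def extCoordChange (e₁ e₁' : Trivialization ℂ (π ℂ L₁)) (e₂ e₂' : Trivialization ℂ (π ℂ L₂))
    [e₁.IsLinear ℂ] [e₂.IsLinear ℂ] [e₁'.IsLinear ℂ] [e₂'.IsLinear ℂ] (p : B₁ × B₂) : ℂ →L[ℂ] ℂ :=
  (e₁.coordChangeL ℂ e₁' p.1 : ℂ →L[ℂ] ℂ).comp (e₂.coordChangeL ℂ e₂' p.2 : ℂ →L[ℂ] ℂ)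

theorem extCoordChange_apply (e₁ e₁' : Trivialization ℂ (π ℂ L₁))
    (e₂ e₂' : Trivialization ℂ (π ℂ L₂))
    [e₁.IsLinear ℂ] [e₂.IsLinear ℂ] [e₁'.IsLinear ℂ] [e₂'.IsLinear ℂ] {p : B₁ × B₂}
    (hp : p ∈ (extPretrivialization e₁ e₂).baseSet ∩ (extPretrivialization e₁' e₂').baseSet)
    (c : ℂ) : extCoordChange e₁ e₁' e₂ e₂' p c =
      (extPretrivialization e₁' e₂' ⟨p, (extPretrivialization e₁ e₂).symm p c⟩).2 := by
  rw [extPretrivialization_symm_apply e₁ e₂ hp.1]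
  change _ = extCoord e₁' e₂' p (c • extFrame e₁ e₂ p)
  rw [map_smul]
  have h₁ : p.1 ∈ e₁.baseSet ∩ e₁'.baseSet := ⟨hp.1.1, hp.2.1⟩
  have h₂ : p.2 ∈ e₂.baseSet ∩ e₂'.baseSet := ⟨hp.1.2, hp.2.2⟩
  have hf : extCoord e₁' e₂' p (extFrame e₁ e₂ p)
      = e₁.coordChangeL ℂ e₁' p.1 1 * e₂.coordChangeL ℂ e₂' p.2 1 := by
    rw [e₁.coordChangeL_apply e₁' h₁, e₂.coordChangeL_apply e₂' h₂]
    change (TensorProduct.lid ℂ ℂ) (TensorProduct.map (e₁'.linearMapAt ℂ p.1)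
      (e₂'.linearMapAt ℂ p.2) (e₁.symm p.1 1 ⊗ₜ[ℂ] e₂.symm p.2 1)) = _
    rw [TensorProduct.map_tmul, TensorProduct.lid_tmul, smul_eq_mul,
      e₁'.linearMapAt_apply, e₂'.linearMapAt_apply, if_pos h₁.2, if_pos h₂.2]
  rw [hf]
  change e₁.coordChangeL ℂ e₁' p.1 (e₂.coordChangeL ℂ e₂' p.2 c) = _
  have l₁ (z : ℂ) : e₁.coordChangeL ℂ e₁' p.1 z = z * e₁.coordChangeL ℂ e₁' p.1 1 := by
    rw [← smul_eq_mul, ← map_smul, smul_eq_mul, mul_one]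
  have l₂ (z : ℂ) : e₂.coordChangeL ℂ e₂' p.2 z = z * e₂.coordChangeL ℂ e₂' p.2 1 := by
    rw [← smul_eq_mul, ← map_smul, smul_eq_mul, mul_one]
  rw [l₁, l₂ c, smul_eq_mul]
  ring

variable (L₁ L₂) in
/-- The line bundle `L₁ ⊠ L₂`, glued from the trivializations `e₁ ⊗ e₂`. -/
def extPrebundle : VectorPrebundle ℂ ℂ (ExtTensor L₁ L₂) where
  pretrivializationAtlas :=
    {e | ∃ (e₁ : Trivialization ℂ (π ℂ L₁)) (e₂ : Trivialization ℂ (π ℂ L₂))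
      (_ : MemTrivializationAtlas e₁) (_ : MemTrivializationAtlas e₂),
      e = extPretrivialization e₁ e₂}
  pretrivialization_linear' := by
    rintro _ ⟨e₁, e₂, h₁, h₂, rfl⟩
    infer_instance
  pretrivializationAt p :=
    extPretrivialization (trivializationAt ℂ L₁ p.1) (trivializationAt ℂ L₂ p.2)
  mem_base_pretrivializationAt p :=
    ⟨mem_baseSet_trivializationAt ℂ L₁ p.1, mem_baseSet_trivializationAt ℂ L₂ p.2⟩
  pretrivialization_mem_atlas p := ⟨_, _, inferInstance, inferInstance, rfl⟩
  exists_coordChange := by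
    rintro _ ⟨e₁, e₂, h₁, h₂, rfl⟩ _ ⟨e₁', e₂', h₁', h₂', rfl⟩
    refine ⟨extCoordChange e₁ e₁' e₂ e₂', ?_, fun p hp c ↦ extCoordChange_apply e₁ e₁' e₂ e₂' hp c⟩
    exact ((continuousOn_coordChange ℂ e₁ e₁').comp continuousOn_fst
      fun p hp ↦ ⟨hp.1.1, hp.2.1⟩).clm_comp
      ((continuousOn_coordChange ℂ e₂ e₂').comp continuousOn_snd fun p hp ↦ ⟨hp.1.2, hp.2.2⟩)
  totalSpaceMk_isInducing p := by
    have h₁ := mem_baseSet_trivializationAt ℂ L₁ p.1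
    have h₂ := mem_baseSet_trivializationAt ℂ L₂ p.2
    let e₁ := trivializationAt ℂ L₁ p.1
    let e₂ := trivializationAt ℂ L₂ p.2
    let T : ExtTensor L₁ L₂ p ≃ₗ[ℂ] ℂ := LinearEquiv.ofBijective (extCoord e₁ e₂ p)
      ⟨fun u v huv ↦ by
          rw [← extCoord_smul_extFrame e₁ e₂ h₁ h₂ u, huv, extCoord_smul_extFrame e₁ e₂ h₁ h₂],
        fun c ↦ ⟨c • extFrame e₁ e₂ p, by
          rw [map_smul, extCoord_extFrame e₁ e₂ h₁ h₂, smul_eq_mul, mul_one]⟩⟩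
    have : FiniteDimensional ℂ (ExtTensor L₁ L₂ p) := T.symm.finiteDimensional
    have hT := T.toContinuousLinearEquiv.toHomeomorph.isInducing
    have hp : Topology.IsInducing (fun c : ℂ ↦ (p, c)) := isInducing_prodMkRight p
    exact hp.comp hT

instance instTopologicalSpaceExtTensor : TopologicalSpace (TotalSpace ℂ (ExtTensor L₁ L₂)) :=
  (extPrebundle L₁ L₂).totalSpaceTopology

instance instFiberBundleExtTensor : FiberBundle ℂ (ExtTensor L₁ L₂) :=
  (extPrebundle L₁ L₂).toFiberBundle

instance instVectorBundleExtTensor : VectorBundle ℂ ℂ (ExtTensor L₁ L₂) :=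
  (extPrebundle L₁ L₂).toVectorBundle

variable {E₁ H₁ E₂ H₂ : Type*} [NormedAddCommGroup E₁] [NormedSpace ℂ E₁] [TopologicalSpace H₁]
  [NormedAddCommGroup E₂] [NormedSpace ℂ E₂] [TopologicalSpace H₂]
  {I₁ : ModelWithCorners ℂ E₁ H₁} {I₂ : ModelWithCorners ℂ E₂ H₂}
  [ChartedSpace H₁ B₁] [ChartedSpace H₂ B₂]
  [ContMDiffVectorBundle ω ℂ L₁ I₁] [ContMDiffVectorBundle ω ℂ L₂ I₂]

instance instContMDiffVectorBundleExtTensor :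
    ContMDiffVectorBundle ω ℂ (ExtTensor L₁ L₂) (I₁.prod I₂) := by
  have : (extPrebundle L₁ L₂).IsContMDiff (I₁.prod I₂) ω := by
    refine ⟨?_⟩
    rintro _ ⟨e₁, e₂, h₁, h₂, rfl⟩ _ ⟨e₁', e₂', h₁', h₂', rfl⟩
    refine ⟨extCoordChange e₁ e₁' e₂ e₂', ?_, fun p hp c ↦ extCoordChange_apply e₁ e₁' e₂ e₂' hp c⟩
    exact ((contMDiffOn_coordChangeL (IB := I₁) (n := ω) e₁ e₁').comp contMDiffOn_fst
      fun p hp ↦ ⟨hp.1.1, hp.2.1⟩).clm_comp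
      ((contMDiffOn_coordChangeL (IB := I₂) (n := ω) e₂ e₂').comp contMDiffOn_snd
        fun p hp ↦ ⟨hp.1.2, hp.2.2⟩)
  exact (extPrebundle L₁ L₂).contMDiffVectorBundle (I₁.prod I₂)

end ExternalTensorProduct

section Sections

variable {E : Type*} [NormedAddCommGroup E] [NormedSpace ℂ E] {H : Type*} [TopologicalSpace H]
  (I : ModelWithCorners ℂ E H) {M : Type*} [TopologicalSpace M] [ChartedSpace H M]
  (L : M → Type*) [∀ x, NormedAddCommGroup (L x)] [∀ x, InnerProductSpace ℂ (L x)]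
  [TopologicalSpace (TotalSpace ℂ L)] [FiberBundle ℂ L] [VectorBundle ℂ ℂ L]

/-- The hermitian metric of the line bundle `L` (the given inner products on the fibres) is smooth:
the squared norm of every local holomorphic frame is a smooth function in every chart. -/
class IsSmoothHermitian : Prop where
  smooth : ∀ (x₀ : M) (e : Trivialization ℂ (π ℂ L)) [MemTrivializationAtlas e],
    ContDiffOn ℝ ∞ (fun z ↦ ‖e.symm ((extChartAt I x₀).symm z) 1‖ ^ 2)
      ((extChartAt I x₀).target ∩ (extChartAt I x₀).symm ⁻¹' e.baseSet)

variable {I L}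

theorem frame_ne_zero (e : Trivialization ℂ (π ℂ L)) [e.IsLinear ℂ] {x : M}
    (hx : x ∈ e.baseSet) : e.symm x 1 ≠ 0 := by
  intro h
  have := e.linearMapAt_symm hx (R := ℂ) 1
  rw [h, map_zero] at this
  exact zero_ne_one this

theorem eq_smul_frame (e : Trivialization ℂ (π ℂ L)) [e.IsLinear ℂ] {x : M}
    (hx : x ∈ e.baseSet) (u : L x) : (e ⟨x, u⟩).2 • e.symm x 1 = u := by
  have h := e.symm_linearMapAt (R := ℂ) hx u
  rwa [e.linearMapAt_apply, if_pos hx, symm_eq_smul e hx] at h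

theorem IsSmoothHermitian.continuousOn [I.Boundaryless] [IsSmoothHermitian I L]
    (e : Trivialization ℂ (π ℂ L)) [MemTrivializationAtlas e] :
    ContinuousOn (fun x ↦ ‖e.symm x 1‖ ^ 2) e.baseSet := by
  intro x₀ hx₀
  have h := (IsSmoothHermitian.smooth (I := I) x₀ e).continuousOn
  have hc : ContinuousOn (extChartAt I x₀) (extChartAt I x₀).source := continuousOn_extChartAt x₀
  have hmaps : MapsTo (extChartAt I x₀) ((extChartAt I x₀).source ∩ e.baseSet)
      ((extChartAt I x₀).target ∩ (extChartAt I x₀).symm ⁻¹' e.baseSet) := by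
    rintro x ⟨h1, h2⟩
    refine ⟨(extChartAt I x₀).map_source h1, ?_⟩
    rw [mem_preimage, (extChartAt I x₀).left_inv h1]
    exact h2
  have h2 := h.comp (hc.mono inter_subset_left) hmaps
  have hmem : (extChartAt I x₀).source ∩ e.baseSet ∈ 𝓝 x₀ :=
    Filter.inter_mem (extChartAt_source_mem_nhds x₀) (e.open_baseSet.mem_nhds hx₀)
  have h3 : ContinuousOn (fun x ↦ ‖e.symm x 1‖ ^ 2) ((extChartAt I x₀).source ∩ e.baseSet) := by
    refine h2.congr fun x hx ↦ ?_
    simp only [Function.comp_apply]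
    rw [(extChartAt I x₀).left_inv hx.1]
  exact (h3.continuousAt hmem).continuousWithinAt

theorem continuousOn_coord (s : Cₛ^ω⟮I; ℂ, L⟯) (e : Trivialization ℂ (π ℂ L))
    [MemTrivializationAtlas e] [ContMDiffVectorBundle ω ℂ L I] :
    ContinuousOn (fun x ↦ (e ⟨x, s x⟩).2) e.baseSet :=
  ((e.contMDiffOn_section_baseSet_iff (IB := I) (n := ω)).1 s.contMDiff.contMDiffOn).continuousOn

variable [ContMDiffVectorBundle ω ℂ L I]

theorem continuous_inner_section [I.Boundaryless] [IsSmoothHermitian I L]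
    (s t : Cₛ^ω⟮I; ℂ, L⟯) : Continuous fun x ↦ inner ℂ (s x) (t x) := by
  rw [continuous_iff_continuousAt]
  intro x₀
  let e := trivializationAt ℂ L x₀
  have hmem : e.baseSet ∈ 𝓝 x₀ := e.open_baseSet.mem_nhds (mem_baseSet_trivializationAt ℂ L x₀)
  have hs := continuousOn_coord s e
  have ht := continuousOn_coord t e
  have hn := IsSmoothHermitian.continuousOn (I := I) e
  have h : ContinuousOn (fun x ↦ (starRingEnd ℂ) (e ⟨x, s x⟩).2 * (e ⟨x, t x⟩).2 *
      ((‖e.symm x 1‖ ^ 2 : ℝ) : ℂ)) e.baseSet :=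
    ((Complex.continuous_conj.comp_continuousOn hs).mul ht).mul
      (Complex.continuous_ofReal.comp_continuousOn hn)
  refine ContinuousOn.continuousAt (h.congr fun x hx ↦ ?_) hmem
  conv_lhs => rw [← eq_smul_frame e hx (s x), ← eq_smul_frame e hx (t x)]
  rw [inner_smul_left, inner_smul_right, inner_self_eq_norm_sq_to_K]
  push_cast
  ring_nf
  rfl

/-- Holomorphic sections vanishing at `x₀` are small near `x₀`, uniformly. -/
theorem exists_nhds_norm_le_half [I.Boundaryless] [IsManifold I ω M] [IsSmoothHermitian I L]
    (x₀ : M) : ∃ V ∈ 𝓝 x₀, ∀ s : Cₛ^ω⟮I; ℂ, L⟯, ∀ S : ℝ, (∀ x, ‖s x‖ ≤ S) → s x₀ = 0 →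
      ∀ x ∈ V, ‖s x‖ ≤ S / 2 := by
  let e := trivializationAt ℂ L x₀
  have he : x₀ ∈ e.baseSet := mem_baseSet_trivializationAt ℂ L x₀
  let φ := extChartAt I x₀
  have hφ : x₀ ∈ φ.source := mem_extChartAt_source x₀
  let N : M → ℝ := fun x ↦ ‖e.symm x 1‖
  have hN : ContinuousAt N x₀ := by
    have h := (IsSmoothHermitian.continuousOn (I := I) e).continuousAt (e.open_baseSet.mem_nhds he)
    have h2 : ContinuousAt (fun x ↦ √(‖e.symm x 1‖ ^ 2)) x₀ := h.sqrt
    simpa [N] using h2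
  have hm : 0 < N x₀ := norm_pos_iff.2 (frame_ne_zero e he)
  set m := N x₀ with hmdef
  have hnb : {x | x ∈ e.baseSet ∧ m / 2 < N x ∧ N x < 2 * m} ∈ 𝓝 x₀ := by
    filter_upwards [e.open_baseSet.mem_nhds he, hN.eventually (lt_mem_nhds (half_lt_self hm)),
      hN.eventually (gt_mem_nhds (show N x₀ < 2 * m by linarith))] with x h1 h2 h3
    exact ⟨h1, h2, h3⟩
  have hsymm : ContinuousAt φ.symm (φ x₀) := continuousAt_extChartAt_symm x₀
  have hnb2 : φ.target ∩ φ.symm ⁻¹' {x | x ∈ e.baseSet ∧ m / 2 < N x ∧ N x < 2 * m}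
      ∈ 𝓝 (φ x₀) := by
    refine Filter.inter_mem (extChartAt_target_mem_nhds x₀) (hsymm ?_)
    rwa [φ.left_inv hφ]
  obtain ⟨r, hr, hball⟩ := Metric.mem_nhds_iff.1 hnb2
  refine ⟨φ.source ∩ φ ⁻¹' Metric.ball (φ x₀) (r / 8), Filter.inter_mem
    (extChartAt_source_mem_nhds x₀) ((continuousAt_extChartAt x₀) (Metric.ball_mem_nhds _
      (by positivity))), ?_⟩
  intro s S hS hs0 x hx
  let f : E → ℂ := fun z ↦ (e ⟨φ.symm z, s (φ.symm z)⟩).2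
  have hnorm : ∀ y ∈ e.baseSet, ‖s y‖ = ‖(e ⟨y, s y⟩).2‖ * N y := by
    intro y hy
    conv_lhs => rw [← eq_smul_frame e hy (s y)]
    rw [norm_smul]
  have hS0 : 0 ≤ S := (norm_nonneg _).trans (hS x₀)
  have hf0 : f (φ x₀) = 0 := by
    have h : 0 = ‖(e ⟨x₀, s x₀⟩).2‖ * m :=
      ((hnorm x₀ he).symm.trans (by rw [hs0, norm_zero])).symm
    have h2 : ‖(e ⟨x₀, s x₀⟩).2‖ = 0 := by
      rcases mul_eq_zero.1 h.symm with h | h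
      · exact h
      · exact absurd h hm.ne'
    change (e ⟨φ.symm (φ x₀), s (φ.symm (φ x₀))⟩).2 = 0
    rw [φ.left_inv hφ]
    exact norm_eq_zero.1 h2
  have hd : DifferentiableOn ℂ f (Metric.ball (φ x₀) r) := by
    have h1 := (e.contMDiffOn_section_baseSet_iff (IB := I) (n := ω)).1 s.contMDiff.contMDiffOn
    have h2 := h1.comp (t := e.baseSet) ((contMDiffOn_extChartAt_symm (I := I) (n := ω) x₀).mono
      (fun z hz ↦ (hball hz).1)) (fun z hz ↦ (hball hz).2.1)
    exact (contMDiffOn_iff_contDiffOn.1 h2).differentiableOn (by simp)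
  have hmaps : MapsTo f (Metric.ball (φ x₀) r) (Metric.closedBall (f (φ x₀)) (2 * S / m)) := by
    intro z hz
    rw [hf0, mem_closedBall_zero_iff]
    obtain ⟨-, hb, hl, -⟩ := hball hz
    have h1 := (hnorm _ hb).symm.trans_le (hS _)
    rw [le_div_iff₀ hm]
    have h2 : ‖f z‖ * (m / 2) ≤ ‖f z‖ * N (φ.symm z) :=
      mul_le_mul_of_nonneg_left hl.le (norm_nonneg _)
    have h3 : ‖f z‖ * N (φ.symm z) ≤ S := h1
    linarith
  have hxb : φ x ∈ Metric.ball (φ x₀) r :=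
    Metric.ball_subset_ball (by linarith) hx.2
  have key := Complex.dist_le_div_mul_dist_of_mapsTo_ball hd hmaps hxb
  rw [hf0, dist_zero_right] at key
  obtain ⟨-, hb, hl, hu⟩ := hball hxb
  have hxx : φ.symm (φ x) = x := φ.left_inv hx.1
  have hfx : ‖s x‖ = ‖f (φ x)‖ * N x := by
    have hb' : x ∈ e.baseSet := hxx ▸ hb
    rw [hnorm x hb']
    change _ = ‖(e ⟨φ.symm (φ x), s (φ.symm (φ x))⟩).2‖ * N x
    rw [hxx]
  rw [hxx] at hu
  have hdist : dist (φ x) (φ x₀) ≤ r / 8 := (Metric.mem_ball.1 hx.2).le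
  calc ‖s x‖ = ‖f (φ x)‖ * N x := hfx
    _ ≤ (2 * S / m / r * dist (φ x) (φ x₀)) * (2 * m) :=
        mul_le_mul key hu.le (norm_nonneg _) (by positivity)
    _ ≤ (2 * S / m / r * (r / 8)) * (2 * m) := by gcongr
    _ = S / 2 := by field_simp; ring

/-- The space of holomorphic sections over a compact complex manifold is finite-dimensional. -/
theorem finiteDimensional_sections [I.Boundaryless] [IsManifold I ω M] [IsSmoothHermitian I L]
    [CompactSpace M] : FiniteDimensional ℂ Cₛ^ω⟮I; ℂ, L⟯ := by
  choose V hV hVs using fun x₀ : M ↦ exists_nhds_norm_le_half (I := I) (L := L) x₀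
  obtain ⟨T, -, hT⟩ := isCompact_univ.elim_nhds_subcover V fun x _ ↦ hV x
  have hfd (x : M) : FiniteDimensional ℂ (L x) :=
    ((trivializationAt ℂ L x).linearEquivAt ℂ x
      (mem_baseSet_trivializationAt ℂ L x)).symm.finiteDimensional
  let ev : Cₛ^ω⟮I; ℂ, L⟯ →ₗ[ℂ] (∀ x : T, L x) :=
    { toFun := fun s x ↦ s x
      map_add' := fun _ _ ↦ rfl
      map_smul' := fun _ _ ↦ rfl }
  refine FiniteDimensional.of_injective ev ?_
  rw [← LinearMap.ker_eq_bot, LinearMap.ker_eq_bot']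
  intro s hs
  rcases isEmpty_or_nonempty M with hM | hM
  · exact ContMDiffSection.ext fun x ↦ hM.elim x
  have hc : Continuous fun x ↦ ‖s x‖ := by
    have h := (Complex.continuous_re.comp (continuous_inner_section s s)).sqrt
    refine h.congr fun x ↦ ?_
    have h2 : (inner ℂ (s x) (s x)).re = ‖s x‖ ^ 2 := inner_self_eq_norm_sq (𝕜 := ℂ) (s x)
    rw [Function.comp_apply, h2, Real.sqrt_sq (norm_nonneg _)]
  obtain ⟨y, -, hy⟩ := isCompact_univ.exists_isMaxOn univ_nonempty hc.continuousOn
  have hmax : ∀ x, ‖s x‖ ≤ ‖s y‖ := fun x ↦ hy (mem_univ x)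
  have hle : ‖s y‖ ≤ ‖s y‖ / 2 := by
    obtain ⟨x, hxT, hxV⟩ := mem_iUnion₂.1 (hT (mem_univ y))
    exact hVs x s _ hmax (congrFun hs ⟨x, hxT⟩) y hxV
  have h0 : ‖s y‖ = 0 := by linarith [norm_nonneg (s y)]
  refine ContMDiffSection.ext fun x ↦ ?_
  exact norm_eq_zero.1 (le_antisymm ((hmax x).trans h0.le) (norm_nonneg _))

end Sections

section Kahler

/-- The model space `ℂ^d`. -/
abbrev ComplexSpace (d : ℕ) : Type := EuclideanSpace ℂ (Fin d)

variable {d : ℕ} {M : Type*} [TopologicalSpace M] [ChartedSpace (ComplexSpace d) M]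

/-- The derivative at `z` of the inverse of the chart at `x₀`: it sends the coordinates of a tangent
vector to the tangent vector. -/
def chartDeriv (x₀ : M) (z : ComplexSpace d) : ComplexSpace d →L[ℂ]
    TangentSpace 𝓘(ℂ, ComplexSpace d) ((extChartAt 𝓘(ℂ, ComplexSpace d) x₀).symm z) :=
  mfderiv 𝓘(ℂ, ComplexSpace d) 𝓘(ℂ, ComplexSpace d) (extChartAt 𝓘(ℂ, ComplexSpace d) x₀).symm z

/-- The expression in the chart at `x₀` of a field `η` of real bilinear forms on the tangent
spaces: `η` at the point with coordinates `z`, evaluated on the tangent vectors with coordinates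
`u` and `v`. -/
def formInChart
    (η : ∀ x : M, TangentSpace 𝓘(ℂ, ComplexSpace d) x →ₗ[ℝ]
      TangentSpace 𝓘(ℂ, ComplexSpace d) x →ₗ[ℝ] ℝ)
    (x₀ : M) (z u v : ComplexSpace d) : ℝ :=
  η ((extChartAt 𝓘(ℂ, ComplexSpace d) x₀).symm z) (chartDeriv x₀ z u) (chartDeriv x₀ z v)

variable (d M) in
/-- A Kähler form on the `d`-dimensional complex manifold `M`: a smooth closed real 2-form of type
`(1,1)` with `ω(v, iv) > 0` for all `v ≠ 0`. -/
structure KahlerForm where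
  /-- The bilinear form on each tangent space. -/
  form : ∀ x : M, TangentSpace 𝓘(ℂ, ComplexSpace d) x →ₗ[ℝ]
    TangentSpace 𝓘(ℂ, ComplexSpace d) x →ₗ[ℝ] ℝ
  alternating : ∀ x v, form x v v = 0
  invariant : ∀ x u v, form x (Complex.I • u) (Complex.I • v) = form x u v
  positive : ∀ x v, v ≠ 0 → 0 < form x v (Complex.I • v)
  smooth : ∀ x₀ u v, ContDiffOn ℝ ∞ (fun z ↦ formInChart form x₀ z u v)
    (extChartAt 𝓘(ℂ, ComplexSpace d) x₀).target
  closed : ∀ x₀ : M, ∀ z ∈ (extChartAt 𝓘(ℂ, ComplexSpace d) x₀).target, ∀ u v w,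
    fderiv ℝ (fun z ↦ formInChart form x₀ z v w) z u
      + fderiv ℝ (fun z ↦ formInChart form x₀ z w u) z v
      + fderiv ℝ (fun z ↦ formInChart form x₀ z u v) z w = 0

namespace KahlerForm

variable (κ : KahlerForm d M)

theorem form_swap (x : M) (u v : TangentSpace 𝓘(ℂ, ComplexSpace d) x) :
    κ.form x v u = -κ.form x u v := by
  have h := κ.alternating x (u + v)
  simp only [map_add, LinearMap.add_apply, κ.alternating, zero_add, add_zero] at h
  linarith

theorem form_I_left (x : M) (u v : TangentSpace 𝓘(ℂ, ComplexSpace d) x) :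
    κ.form x (Complex.I • u) v = -κ.form x u (Complex.I • v) := by
  have h := κ.invariant x u (Complex.I • v)
  rw [smul_smul, Complex.I_mul_I, neg_one_smul, map_neg] at h
  linarith

theorem form_I_symm (x : M) (u v : TangentSpace 𝓘(ℂ, ComplexSpace d) x) :
    κ.form x v (Complex.I • u) = κ.form x u (Complex.I • v) := by
  rw [κ.form_swap, κ.form_I_left, neg_neg]

/-- The hermitian form `ω(u, iv) + i ω(u, v)` of the Kähler metric, conjugate-linear in `u` and
linear in `v`. -/
def herm (x : M) (u v : TangentSpace 𝓘(ℂ, ComplexSpace d) x) : ℂ :=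
  κ.form x u (Complex.I • v) + Complex.I * κ.form x u v

theorem real_smul_eq (x : M) (r : ℝ) (v : TangentSpace 𝓘(ℂ, ComplexSpace d) x) :
    (r : ℂ) • v = r • v := rfl

theorem herm_add_left (x : M) (u u' v : TangentSpace 𝓘(ℂ, ComplexSpace d) x) :
    κ.herm x (u + u') v = κ.herm x u v + κ.herm x u' v := by
  simp only [herm, map_add, LinearMap.add_apply, Complex.ofReal_add]; ring

theorem herm_swap (x : M) (u v : TangentSpace 𝓘(ℂ, ComplexSpace d) x) :
    κ.herm x v u = (starRingEnd ℂ) (κ.herm x u v) := by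
  simp only [herm, map_add, map_mul, Complex.conj_ofReal, Complex.conj_I]
  rw [κ.form_I_symm, κ.form_swap x u v]
  push_cast; ring

theorem herm_smul_right (x : M) (c : ℂ) (u v : TangentSpace 𝓘(ℂ, ComplexSpace d) x) :
    κ.herm x u (c • v) = c * κ.herm x u v := by
  have h : c • v = c.re • v + c.im • (Complex.I • v) := by
    rw [← real_smul_eq, ← real_smul_eq, smul_smul, ← add_smul, Complex.re_add_im]
  have h2 : Complex.I • (c • v) = c.re • (Complex.I • v) - c.im • v := by
    rw [← real_smul_eq, ← real_smul_eq, smul_smul, smul_smul, ← sub_smul]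
    congr 1
    conv_lhs => rw [← Complex.re_add_im c]
    linear_combination (c.im : ℂ) * Complex.I_mul_I
  simp only [herm]
  rw [h2, h]
  simp only [map_add, map_sub, map_smul, smul_eq_mul]
  conv_rhs => rw [← Complex.re_add_im c]
  push_cast
  linear_combination (-(c.im : ℂ) * κ.form x u v) * Complex.I_mul_I

theorem herm_add_right (x : M) (u v v' : TangentSpace 𝓘(ℂ, ComplexSpace d) x) :
    κ.herm x u (v + v') = κ.herm x u v + κ.herm x u v' := by
  simp only [herm, smul_add, map_add, Complex.ofReal_add]; ring

theorem herm_smul_left (x : M) (c : ℂ) (u v : TangentSpace 𝓘(ℂ, ComplexSpace d) x) :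
    κ.herm x (c • u) v = (starRingEnd ℂ) c * κ.herm x u v := by
  rw [κ.herm_swap, κ.herm_smul_right, map_mul, ← κ.herm_swap]

/-- The matrix of the hermitian form in the coordinate frame of the chart at `x₀`; that is,
`ω = (i/2) ∑ g_{jk} dz_j ∧ dz̄_k` with `g` the transpose of this matrix. -/
def chartMatrix (x₀ : M) (z : ComplexSpace d) : Matrix (Fin d) (Fin d) ℂ := Matrix.of fun j k ↦
  formInChart κ.form x₀ z (EuclideanSpace.single j 1) (Complex.I • EuclideanSpace.single k 1)
    + Complex.I *
      formInChart κ.form x₀ z (EuclideanSpace.single j 1) (EuclideanSpace.single k 1)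

/-- The density `det (g_{jk})` of the volume form `ω^d / d!` in the chart at `x₀`, with respect to
the Lebesgue measure of `ℂ^d`. -/
def chartDensity (x₀ : M) (z : ComplexSpace d) : ℝ := (κ.chartMatrix x₀ z).det.re

/-- The measure of `ω^d / d!` on the domain of the chart at `x₀`, extended by zero. -/
def chartMeasure [MeasurableSpace M] (x₀ : M) : Measure M :=
  (((volume : Measure (ComplexSpace d)).restrict
    (extChartAt 𝓘(ℂ, ComplexSpace d) x₀).target).withDensity
      fun z ↦ ENNReal.ofReal (κ.chartDensity x₀ z)).map
        (extChartAt 𝓘(ℂ, ComplexSpace d) x₀).symm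

/-- The measure on `M` associated to the volume form `ω^d / d!`: the local measures
agree on the overlaps of the charts, so that their supremum restricts to each of
them. -/
def volumeMeasure [MeasurableSpace M] : Measure M := ⨆ x₀ : M, κ.chartMeasure x₀

/-- The hermitian form in a chart. -/
def chartHerm (x₀ : M) (z : ComplexSpace d) : ComplexSpace d →ₗ⋆[ℂ] ComplexSpace d →ₗ[ℂ] ℂ :=
  LinearMap.mk₂'ₛₗ (starRingEnd ℂ) (RingHom.id ℂ)
    (fun u v ↦ κ.herm _ (chartDeriv x₀ z u) (chartDeriv x₀ z v))
    (fun u u' v ↦ by rw [map_add, κ.herm_add_left])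
    (fun c u v ↦ by rw [map_smul, κ.herm_smul_left, smul_eq_mul])
    (fun u v v' ↦ by rw [map_add, κ.herm_add_right])
    (fun c u v ↦ by rw [map_smul, κ.herm_smul_right, smul_eq_mul, RingHom.id_apply])

theorem chartMatrix_apply (x₀ : M) (z : ComplexSpace d) (j k : Fin d) :
    κ.chartMatrix x₀ z j k =
      κ.chartHerm x₀ z (EuclideanSpace.single j 1) (EuclideanSpace.single k 1) := by
  change _ = κ.herm _ (chartDeriv x₀ z _) (chartDeriv x₀ z _)
  rw [chartMatrix, Matrix.of_apply, formInChart, formInChart, map_smul, herm]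

theorem sum_single (u : ComplexSpace d) : u = ∑ j, u j • EuclideanSpace.single j (1 : ℂ) := by
  ext i
  simp [Pi.single_apply]

theorem chartHerm_apply (x₀ : M) (z u v : ComplexSpace d) :
    κ.chartHerm x₀ z u v = ∑ j, ∑ k, (starRingEnd ℂ) (u j) * κ.chartMatrix x₀ z j k * v k := by
  conv_lhs => rw [sum_single u, sum_single v]
  simp only [map_sum, LinearMap.sum_apply, LinearMap.map_smulₛₗ, LinearMap.smul_apply, map_smul,
    smul_eq_mul, κ.chartMatrix_apply, Finset.mul_sum]
  rw [Finset.sum_comm]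
  refine Finset.sum_congr rfl fun j _ ↦ Finset.sum_congr rfl fun k _ ↦ ?_
  ring

variable [IsManifold 𝓘(ℂ, ComplexSpace d) ω M]

theorem chartDeriv_injective (x₀ : M) {z : ComplexSpace d}
    (hz : z ∈ (extChartAt 𝓘(ℂ, ComplexSpace d) x₀).target) :
    Function.Injective (chartDeriv x₀ z) := by
  have : IsManifold 𝓘(ℂ, ComplexSpace d) 1 M := .of_le (n := ω) (by simp)
  have h := mfderiv_extChartAt_comp_mfderivWithin_extChartAt_symm hz
  rw [ModelWithCorners.range_eq_univ, mfderivWithin_univ] at h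
  intro u v huv
  have hu := DFunLike.congr_fun h u
  have hv := DFunLike.congr_fun h v
  have h2 : (mfderiv 𝓘(ℂ, ComplexSpace d) 𝓘(ℂ, ComplexSpace d)
      (extChartAt 𝓘(ℂ, ComplexSpace d) x₀) ((extChartAt 𝓘(ℂ, ComplexSpace d) x₀).symm z))
        (chartDeriv x₀ z u) = (mfderiv 𝓘(ℂ, ComplexSpace d) 𝓘(ℂ, ComplexSpace d)
      (extChartAt 𝓘(ℂ, ComplexSpace d) x₀) ((extChartAt 𝓘(ℂ, ComplexSpace d) x₀).symm z))
        (chartDeriv x₀ z v) := by rw [huv]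
  exact hu.symm.trans (h2.trans hv)

open scoped ComplexOrder in
theorem chartMatrix_posDef (x₀ : M) {z : ComplexSpace d}
    (hz : z ∈ (extChartAt 𝓘(ℂ, ComplexSpace d) x₀).target) : (κ.chartMatrix x₀ z).PosDef := by
  refine .of_dotProduct_mulVec_pos ?_ fun v hv ↦ ?_
  · ext j k
    rw [Matrix.conjTranspose_apply, κ.chartMatrix_apply, κ.chartMatrix_apply]
    exact (κ.herm_swap _ _ _).symm
  · let u : ComplexSpace d := WithLp.toLp 2 v
    have hu : u ≠ 0 := fun h ↦ hv (by simpa [u] using congrArg WithLp.ofLp h)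
    have h1 : star v ⬝ᵥ (κ.chartMatrix x₀ z).mulVec v = κ.chartHerm x₀ z u u := by
      rw [κ.chartHerm_apply]
      simp only [dotProduct, Matrix.mulVec, Finset.mul_sum]
      refine Finset.sum_congr rfl fun j _ ↦ Finset.sum_congr rfl fun k _ ↦ ?_
      simp only [u, Pi.star_apply, mul_assoc]
      rfl
    have hne : chartDeriv x₀ z u ≠ 0 := by
      rw [← map_zero (chartDeriv x₀ z)]
      exact (chartDeriv_injective x₀ hz).ne hu
    have h2 : κ.chartHerm x₀ z u u =
        ((κ.form _ (chartDeriv x₀ z u) (Complex.I • chartDeriv x₀ z u) : ℝ) : ℂ) := by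
      change κ.herm _ (chartDeriv x₀ z u) (chartDeriv x₀ z u) = _
      simp only [herm, κ.alternating, Complex.ofReal_zero, mul_zero, add_zero]
    rw [h1, h2]
    exact_mod_cast κ.positive _ _ hne

open scoped ComplexOrder in
theorem chartMatrix_det (x₀ : M) {z : ComplexSpace d}
    (hz : z ∈ (extChartAt 𝓘(ℂ, ComplexSpace d) x₀).target) :
    (κ.chartMatrix x₀ z).det = (κ.chartDensity x₀ z : ℂ) ∧ 0 < κ.chartDensity x₀ z := by
  have h := (κ.chartMatrix_posDef x₀ hz).det_pos
  rw [Complex.lt_def] at h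
  refine ⟨Complex.ext rfl ?_, h.1⟩
  rw [← h.2]
  rfl

theorem chartDensity_continuousOn (x₀ : M) :
    ContinuousOn (κ.chartDensity x₀) (extChartAt 𝓘(ℂ, ComplexSpace d) x₀).target := by
  have hm : ContinuousOn (κ.chartMatrix x₀) (extChartAt 𝓘(ℂ, ComplexSpace d) x₀).target := by
    refine continuousOn_pi.2 fun j ↦ continuousOn_pi.2 fun k ↦ ?_
    exact (Complex.continuous_ofReal.comp_continuousOn (κ.smooth x₀ _ _).continuousOn).add
      (continuousOn_const.mul
        (Complex.continuous_ofReal.comp_continuousOn (κ.smooth x₀ _ _).continuousOn))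
  exact Complex.continuous_re.comp_continuousOn
    ((continuous_id.matrix_det).comp_continuousOn hm)

/-- The coordinate change from the chart at `x₀` to the chart at `y₀`. -/
def transition (x₀ y₀ : M) (z : ComplexSpace d) : ComplexSpace d :=
  extChartAt 𝓘(ℂ, ComplexSpace d) y₀ ((extChartAt 𝓘(ℂ, ComplexSpace d) x₀).symm z)

variable (d) in
/-- The domain of the coordinate change. -/
def overlap (x₀ y₀ : M) : Set (ComplexSpace d) :=
  (extChartAt 𝓘(ℂ, ComplexSpace d) x₀).target ∩
    (extChartAt 𝓘(ℂ, ComplexSpace d) x₀).symm ⁻¹' (extChartAt 𝓘(ℂ, ComplexSpace d) y₀).source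

theorem isOpen_overlap (x₀ y₀ : M) : IsOpen (overlap d x₀ y₀) :=
  (continuousOn_extChartAt_symm x₀).isOpen_inter_preimage (isOpen_extChartAt_target x₀)
    (isOpen_extChartAt_source y₀)

theorem transition_differentiableAt (x₀ y₀ : M) {z : ComplexSpace d} (hz : z ∈ overlap d x₀ y₀) :
    DifferentiableAt ℂ (transition (d := d) x₀ y₀) z := by
  have h := contDiffOn_ext_coord_change (I := 𝓘(ℂ, ComplexSpace d)) (n := ω) y₀ x₀
  have hs : ((extChartAt 𝓘(ℂ, ComplexSpace d) x₀).symm ≫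
      extChartAt 𝓘(ℂ, ComplexSpace d) y₀).source = overlap d x₀ y₀ := by
    rw [PartialEquiv.trans_source]; rfl
  rw [hs] at h
  exact (h.differentiableOn (by simp)).differentiableAt ((isOpen_overlap x₀ y₀).mem_nhds hz)

theorem mdiff_symm (y₀ : M) {w : ComplexSpace d}
    (hw : w ∈ (extChartAt 𝓘(ℂ, ComplexSpace d) y₀).target) :
    MDifferentiableAt 𝓘(ℂ, ComplexSpace d) 𝓘(ℂ, ComplexSpace d)
      (extChartAt 𝓘(ℂ, ComplexSpace d) y₀).symm w := by
  have : IsManifold 𝓘(ℂ, ComplexSpace d) 1 M := .of_le (n := ω) (by simp)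
  have h := mdifferentiableWithinAt_extChartAt_symm hw
  rwa [ModelWithCorners.range_eq_univ, mdifferentiableWithinAt_univ] at h

theorem chartHerm_transition (x₀ y₀ : M) {z : ComplexSpace d} (hz : z ∈ overlap d x₀ y₀)
    (u v : ComplexSpace d) :
    κ.chartHerm x₀ z u v = κ.chartHerm y₀ (transition x₀ y₀ z)
      (fderiv ℂ (transition x₀ y₀) z u) (fderiv ℂ (transition x₀ y₀) z v) := by
  have hw : transition x₀ y₀ z ∈ (extChartAt 𝓘(ℂ, ComplexSpace d) y₀).target :=
    (extChartAt 𝓘(ℂ, ComplexSpace d) y₀).map_source hz.2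
  have hT := transition_differentiableAt x₀ y₀ hz
  have heq : (extChartAt 𝓘(ℂ, ComplexSpace d) x₀).symm =ᶠ[𝓝 z]
      (extChartAt 𝓘(ℂ, ComplexSpace d) y₀).symm ∘ transition x₀ y₀ := by
    filter_upwards [(isOpen_overlap x₀ y₀).mem_nhds hz] with w hw
    exact ((extChartAt 𝓘(ℂ, ComplexSpace d) y₀).left_inv hw.2).symm
  have hcomp : HasMFDerivAt 𝓘(ℂ, ComplexSpace d) 𝓘(ℂ, ComplexSpace d)
      (extChartAt 𝓘(ℂ, ComplexSpace d) x₀).symm z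
      ((chartDeriv y₀ (transition x₀ y₀ z)).comp (fderiv ℂ (transition x₀ y₀) z)) := by
    have h1 : HasMFDerivAt 𝓘(ℂ, ComplexSpace d) 𝓘(ℂ, ComplexSpace d) (transition x₀ y₀) z
        (fderiv ℂ (transition x₀ y₀) z) := hT.hasFDerivAt.hasMFDerivAt
    exact ((mdiff_symm y₀ hw).hasMFDerivAt.comp z h1).congr_of_eventuallyEq heq
  have hp : (extChartAt 𝓘(ℂ, ComplexSpace d) y₀).symm (transition x₀ y₀ z) =
      (extChartAt 𝓘(ℂ, ComplexSpace d) x₀).symm z :=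
    (extChartAt 𝓘(ℂ, ComplexSpace d) y₀).left_inv hz.2
  have hd : ∀ a : ComplexSpace d, (chartDeriv x₀ z a : ComplexSpace d) =
      chartDeriv y₀ (transition x₀ y₀ z) (fderiv ℂ (transition x₀ y₀) z a) := fun a ↦
    DFunLike.congr_fun hcomp.mfderiv a
  have aux : ∀ (p q : M) (_ : p = q) (a b : ComplexSpace d),
      κ.herm p a b = κ.herm q a b := by
    rintro p _ rfl a b; rfl
  change κ.herm _ (chartDeriv x₀ z u) (chartDeriv x₀ z v) = κ.herm _ _ _
  refine (aux _ _ hp.symm _ _).trans ?_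
  rw [hd u, hd v]

theorem chartDensity_transition (x₀ y₀ : M) {z : ComplexSpace d} (hz : z ∈ overlap d x₀ y₀) :
    κ.chartDensity x₀ z = |((fderiv ℂ (transition x₀ y₀) z).restrictScalars ℝ).det| *
      κ.chartDensity y₀ (transition x₀ y₀ z) := by
  have hw : transition x₀ y₀ z ∈ (extChartAt 𝓘(ℂ, ComplexSpace d) y₀).target :=
    (extChartAt 𝓘(ℂ, ComplexSpace d) y₀).map_source hz.2
  set D := fderiv ℂ (transition (d := d) x₀ y₀) z with hD
  let b := (EuclideanSpace.basisFun (Fin d) ℂ).toBasis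
  let A : Matrix (Fin d) (Fin d) ℂ := LinearMap.toMatrix b b D.toLinearMap
  have hA : ∀ j k, A j k = D (EuclideanSpace.single k 1) j := by
    intro j k
    simp [A, b, LinearMap.toMatrix_apply]
  have hmat : κ.chartMatrix x₀ z = A.conjTranspose * κ.chartMatrix y₀ (transition x₀ y₀ z) * A := by
    ext j k
    rw [κ.chartMatrix_apply, κ.chartHerm_transition x₀ y₀ hz, κ.chartHerm_apply, Matrix.mul_apply]
    simp only [Matrix.mul_apply, Finset.sum_mul, Matrix.conjTranspose_apply, hA]
    rw [Finset.sum_comm]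
    rfl
  have hdetA : A.det = LinearMap.det D.toLinearMap := LinearMap.det_toMatrix b _
  have hreal : (D.restrictScalars ℝ).det = Complex.normSq A.det := by
    rw [hdetA, ← Algebra.norm_complex_apply, ← LinearMap.det_restrictScalars]
    rfl
  have hdet := congrArg Matrix.det hmat
  rw [Matrix.det_mul, Matrix.det_mul, Matrix.det_conjTranspose, (κ.chartMatrix_det x₀ hz.1).1,
    (κ.chartMatrix_det y₀ hw).1] at hdet
  have : ((κ.chartDensity x₀ z : ℝ) : ℂ) =
      ((Complex.normSq A.det * κ.chartDensity y₀ (transition x₀ y₀ z) : ℝ) : ℂ) := by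
    rw [hdet, Complex.ofReal_mul, Complex.normSq_eq_conj_mul_self]
    change (starRingEnd ℂ) A.det * _ * _ = _
    ring
  rw [hreal, abs_of_nonneg (Complex.normSq_nonneg _)]
  exact_mod_cast this

variable [MeasurableSpace M] [BorelSpace M]

theorem chartMeasure_apply (x₀ : M) {B : Set M} (hB : MeasurableSet B) :
    κ.chartMeasure x₀ B = ∫⁻ z in (extChartAt 𝓘(ℂ, ComplexSpace d) x₀).target ∩
      (extChartAt 𝓘(ℂ, ComplexSpace d) x₀).symm ⁻¹' B, ENNReal.ofReal (κ.chartDensity x₀ z) := by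
  have ht : MeasurableSet (extChartAt 𝓘(ℂ, ComplexSpace d) x₀).target :=
    (isOpen_extChartAt_target x₀).measurableSet
  have hm : AEMeasurable (extChartAt 𝓘(ℂ, ComplexSpace d) x₀).symm
      ((volume : Measure (ComplexSpace d)).restrict
        (extChartAt 𝓘(ℂ, ComplexSpace d) x₀).target) :=
    (continuousOn_extChartAt_symm x₀).aemeasurable ht
  have hm' := hm.mono_ac (withDensity_absolutelyContinuous _
    (fun z ↦ ENNReal.ofReal (κ.chartDensity x₀ z)))
  have hnull : NullMeasurableSet ((extChartAt 𝓘(ℂ, ComplexSpace d) x₀).symm ⁻¹' B)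
      ((volume : Measure (ComplexSpace d)).restrict
        (extChartAt 𝓘(ℂ, ComplexSpace d) x₀).target) := hm.nullMeasurable hB
  rw [chartMeasure, Measure.map_apply_of_aemeasurable hm' hB, withDensity_apply₀ _ hnull,
    Measure.restrict_restrict₀ hnull, inter_comm]

theorem measurableSet_chart_preimage (x₀ : M) {B : Set M} (hB : MeasurableSet B) :
    MeasurableSet ((extChartAt 𝓘(ℂ, ComplexSpace d) x₀).target ∩
      (extChartAt 𝓘(ℂ, ComplexSpace d) x₀).symm ⁻¹' B) := by
  have ht : MeasurableSet (extChartAt 𝓘(ℂ, ComplexSpace d) x₀).target :=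
    (isOpen_extChartAt_target x₀).measurableSet
  have hr : Measurable ((extChartAt 𝓘(ℂ, ComplexSpace d) x₀).target.domRestrict
      (extChartAt 𝓘(ℂ, ComplexSpace d) x₀).symm) :=
    (continuousOn_iff_continuous_domRestrict.1 (continuousOn_extChartAt_symm x₀)).measurable
  have h := ht.subtype_image (hr hB)
  convert h using 1
  ext z
  constructor
  · rintro ⟨h1, h2⟩
    exact ⟨⟨z, h1⟩, h2, rfl⟩
  · rintro ⟨⟨z, h1⟩, h2, rfl⟩
    exact ⟨h1, h2⟩

theorem chartMeasure_eq (x₀ y₀ : M) {B : Set M} (hB : MeasurableSet B)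
    (hx : B ⊆ (extChartAt 𝓘(ℂ, ComplexSpace d) x₀).source)
    (hy : B ⊆ (extChartAt 𝓘(ℂ, ComplexSpace d) y₀).source) :
    κ.chartMeasure y₀ B = κ.chartMeasure x₀ B := by
  rw [κ.chartMeasure_apply y₀ hB, κ.chartMeasure_apply x₀ hB]
  set A := (extChartAt 𝓘(ℂ, ComplexSpace d) x₀).target ∩
      (extChartAt 𝓘(ℂ, ComplexSpace d) x₀).symm ⁻¹' B with hA
  have hAo : A ⊆ overlap d x₀ y₀ := fun z hz ↦ ⟨hz.1, hy hz.2⟩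
  have himg : (extChartAt 𝓘(ℂ, ComplexSpace d) y₀).target ∩
      (extChartAt 𝓘(ℂ, ComplexSpace d) y₀).symm ⁻¹' B = transition x₀ y₀ '' A := by
    ext w
    constructor
    · rintro ⟨hw, hwB⟩
      have hs := hx hwB
      refine ⟨extChartAt 𝓘(ℂ, ComplexSpace d) x₀
        ((extChartAt 𝓘(ℂ, ComplexSpace d) y₀).symm w),
        ⟨(extChartAt 𝓘(ℂ, ComplexSpace d) x₀).map_source hs, ?_⟩, ?_⟩
      · rw [mem_preimage, (extChartAt 𝓘(ℂ, ComplexSpace d) x₀).left_inv hs]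
        exact hwB
      · rw [transition, (extChartAt 𝓘(ℂ, ComplexSpace d) x₀).left_inv hs,
          (extChartAt 𝓘(ℂ, ComplexSpace d) y₀).right_inv hw]
    · rintro ⟨z, hz, rfl⟩
      refine ⟨(extChartAt 𝓘(ℂ, ComplexSpace d) y₀).map_source (hy hz.2), ?_⟩
      rw [mem_preimage, transition, (extChartAt 𝓘(ℂ, ComplexSpace d) y₀).left_inv (hy hz.2)]
      exact hz.2
  have hinj : InjOn (transition (d := d) x₀ y₀) A := by
    intro z hz z' hz' h
    exact (extChartAt 𝓘(ℂ, ComplexSpace d) x₀).symm.injOn hz.1 hz'.1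
      ((extChartAt 𝓘(ℂ, ComplexSpace d) y₀).injOn (hy hz.2) (hy hz'.2) h)
  have hAm : MeasurableSet A := measurableSet_chart_preimage x₀ hB
  rw [himg, lintegral_image_eq_lintegral_abs_det_fderiv_mul volume hAm
    (fun z hz ↦ ((transition_differentiableAt x₀ y₀
      (hAo hz)).hasFDerivAt.restrictScalars ℝ).hasFDerivWithinAt) hinj]
  refine setLIntegral_congr_fun hAm fun z hz ↦ ?_
  rw [κ.chartDensity_transition x₀ y₀ (hAo hz), ENNReal.ofReal_mul (abs_nonneg _)]

theorem chartMeasure_eq_zero (y₀ : M) {B : Set M} (hB : MeasurableSet B)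
    (hy : Disjoint B (extChartAt 𝓘(ℂ, ComplexSpace d) y₀).source) : κ.chartMeasure y₀ B = 0 := by
  rw [κ.chartMeasure_apply y₀ hB]
  have : (extChartAt 𝓘(ℂ, ComplexSpace d) y₀).target ∩
      (extChartAt 𝓘(ℂ, ComplexSpace d) y₀).symm ⁻¹' B = ∅ := by
    refine eq_empty_of_forall_notMem fun z hz ↦ ?_
    exact hy.le_bot ⟨hz.2, (extChartAt 𝓘(ℂ, ComplexSpace d) y₀).map_target hz.1⟩
  rw [this, Measure.restrict_empty, lintegral_zero_measure]

theorem chartMeasure_le (x₀ y₀ : M) {B : Set M} (hB : MeasurableSet B)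
    (hx : B ⊆ (extChartAt 𝓘(ℂ, ComplexSpace d) x₀).source) :
    κ.chartMeasure y₀ B ≤ κ.chartMeasure x₀ B := by
  have hs : MeasurableSet (extChartAt 𝓘(ℂ, ComplexSpace d) y₀).source :=
    (isOpen_extChartAt_source y₀).measurableSet
  rw [← measure_inter_add_sdiff B hs, κ.chartMeasure_eq_zero y₀ (hB.diff hs) disjoint_sdiff_left,
    add_zero, κ.chartMeasure_eq x₀ y₀ (hB.inter hs) (inter_subset_left.trans hx) inter_subset_right]
  exact measure_mono inter_subset_left

theorem exists_nhds_chartMeasure_lt_top (x₀ : M) :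
    ∃ U, IsOpen U ∧ x₀ ∈ U ∧ U ⊆ (extChartAt 𝓘(ℂ, ComplexSpace d) x₀).source ∧
      κ.chartMeasure x₀ U < ⊤ := by
  set φ := extChartAt 𝓘(ℂ, ComplexSpace d) x₀ with hφ
  have hx : x₀ ∈ φ.source := mem_extChartAt_source x₀
  have hnt : φ.target ∈ 𝓝 (φ x₀) := extChartAt_target_mem_nhds x₀
  have hc : ContinuousAt (κ.chartDensity x₀) (φ x₀) :=
    (κ.chartDensity_continuousOn x₀).continuousAt hnt
  have hn : φ.target ∩ {z | κ.chartDensity x₀ z < κ.chartDensity x₀ (φ x₀) + 1} ∈ 𝓝 (φ x₀) :=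
    Filter.inter_mem hnt (hc.eventually (gt_mem_nhds (lt_add_one _)))
  obtain ⟨r, hr, hball⟩ := Metric.mem_nhds_iff.1 hn
  refine ⟨φ.source ∩ φ ⁻¹' Metric.ball (φ x₀) r,
    (continuousOn_extChartAt x₀).isOpen_inter_preimage (isOpen_extChartAt_source x₀)
      Metric.isOpen_ball, ⟨hx, Metric.mem_ball_self hr⟩, inter_subset_left, ?_⟩
  have hU : MeasurableSet (φ.source ∩ φ ⁻¹' Metric.ball (φ x₀) r) :=
    ((continuousOn_extChartAt x₀).isOpen_inter_preimage (isOpen_extChartAt_source x₀)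
      Metric.isOpen_ball).measurableSet
  rw [κ.chartMeasure_apply x₀ hU]
  have hsub : φ.target ∩ φ.symm ⁻¹' (φ.source ∩ φ ⁻¹' Metric.ball (φ x₀) r) ⊆
      Metric.ball (φ x₀) r := by
    rintro z ⟨hz, -, hz2⟩
    rwa [mem_preimage, φ.right_inv hz] at hz2
  calc _ ≤ ∫⁻ z in Metric.ball (φ x₀) r, ENNReal.ofReal (κ.chartDensity x₀ z) :=
        lintegral_mono_set hsub
    _ ≤ ∫⁻ _ in Metric.ball (φ x₀) r, ENNReal.ofReal (κ.chartDensity x₀ (φ x₀) + 1) :=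
        setLIntegral_mono' Metric.isOpen_ball.measurableSet
          fun z hz ↦ ENNReal.ofReal_le_ofReal (hball hz).2.le
    _ < ⊤ := by
        rw [setLIntegral_const]
        exact ENNReal.mul_lt_top ENNReal.ofReal_lt_top Metric.isBounded_ball.measure_lt_top

instance isFiniteMeasure_volumeMeasure [CompactSpace M] : IsFiniteMeasure κ.volumeMeasure := by
  choose U hUo hxU hUs hUf using κ.exists_nhds_chartMeasure_lt_top
  obtain ⟨T, -, hT⟩ := isCompact_univ.elim_nhds_subcover U fun x _ ↦ (hUo x).mem_nhds (hxU x)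
  let ν : Measure M := ∑ x ∈ T, (κ.chartMeasure x).restrict (U x)
  have hle : κ.volumeMeasure ≤ ν := by
    refine iSup_le fun y ↦ Measure.le_iff.2 fun B hB ↦ ?_
    have hcov : B ⊆ ⋃ x ∈ T, B ∩ U x := by
      intro p hp
      obtain ⟨x, hxT, hpx⟩ := mem_iUnion₂.1 (hT (mem_univ p))
      exact mem_iUnion₂.2 ⟨x, hxT, hp, hpx⟩
    calc κ.chartMeasure y B ≤ κ.chartMeasure y (⋃ x ∈ T, B ∩ U x) := measure_mono hcov
      _ ≤ ∑ x ∈ T, κ.chartMeasure y (B ∩ U x) := measure_biUnion_finset_le _ _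
      _ ≤ ∑ x ∈ T, κ.chartMeasure x (B ∩ U x) := Finset.sum_le_sum fun x _ ↦
          κ.chartMeasure_le x y (hB.inter (hUo x).measurableSet) (inter_subset_right.trans (hUs x))
      _ = ν B := by
          simp only [ν, Measure.coe_finsetSum, Finset.sum_apply]
          exact Finset.sum_congr rfl fun x _ ↦ (Measure.restrict_apply hB).symm
  refine ⟨(hle univ).trans_lt ?_⟩
  simp only [ν, Measure.coe_finsetSum, Finset.sum_apply]
  refine ENNReal.sum_lt_top.2 fun x _ ↦ ?_
  rw [Measure.restrict_apply_univ]
  exact hUf x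

instance isOpenPosMeasure_volumeMeasure : κ.volumeMeasure.IsOpenPosMeasure := by
  refine ⟨fun U hU hne h0 ↦ ?_⟩
  obtain ⟨x₀, hx₀⟩ := hne
  have h1 : κ.chartMeasure x₀ U = 0 :=
    le_antisymm ((le_iSup κ.chartMeasure x₀ U).trans h0.le) zero_le
  set φ := extChartAt 𝓘(ℂ, ComplexSpace d) x₀ with hφ
  have hV : IsOpen (φ.target ∩ φ.symm ⁻¹' U) :=
    (continuousOn_extChartAt_symm x₀).isOpen_inter_preimage (isOpen_extChartAt_target x₀) hU
  have hVne : (φ.target ∩ φ.symm ⁻¹' U).Nonempty := by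
    refine ⟨φ x₀, mem_extChartAt_target x₀, ?_⟩
    rw [mem_preimage, φ.left_inv (mem_extChartAt_source x₀)]
    exact hx₀
  rw [κ.chartMeasure_apply x₀ hU.measurableSet] at h1
  have hmeas : AEMeasurable (fun z ↦ ENNReal.ofReal (κ.chartDensity x₀ z))
      (volume.restrict (φ.target ∩ φ.symm ⁻¹' U)) :=
    (((κ.chartDensity_continuousOn x₀).mono inter_subset_left).aemeasurable
      hV.measurableSet).ennreal_ofReal
  rw [lintegral_eq_zero_iff' hmeas, Filter.EventuallyEq,
    ae_restrict_iff' hV.measurableSet] at h1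
  have h2 : volume (φ.target ∩ φ.symm ⁻¹' U) = 0 := by
    refine measure_mono_null (fun z hz ↦ ?_) h1
    simp only [mem_compl_iff, mem_ofPred_eq, Classical.not_imp]
    refine ⟨hz, ?_⟩
    simp only [Pi.zero_apply, ENNReal.ofReal_eq_zero, not_le]
    exact (κ.chartMatrix_det x₀ hz.1).2
  exact (hV.measure_pos volume hVne).ne' h2

end KahlerForm

end Kahler

section QuantumSpace

variable {E : Type*} [NormedAddCommGroup E] [NormedSpace ℂ E] {H : Type*} [TopologicalSpace H]
  (I : ModelWithCorners ℂ E H) {M : Type*} [TopologicalSpace M] [ChartedSpace H M]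
  (L : M → Type*) [∀ x, NormedAddCommGroup (L x)] [∀ x, InnerProductSpace ℂ (L x)]
  [TopologicalSpace (TotalSpace ℂ L)] [FiberBundle ℂ L] [VectorBundle ℂ ℂ L]

/-- The line bundle `L` is very ample: its global holomorphic sections have no common zero,
separate points, and separate tangent vectors; that is, they embed the compact manifold `M` in
projective space. -/
structure IsVeryAmple : Prop where
  base_point_free : ∀ x, ∃ s : Cₛ^ω⟮I; ℂ, L⟯, s x ≠ 0
  separates_points : ∀ x y, x ≠ y → ∃ s : Cₛ^ω⟮I; ℂ, L⟯, s x = 0 ∧ s y ≠ 0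
  separates_tangents : ∀ x, ∀ v : TangentSpace I x, v ≠ 0 → ∃ s : Cₛ^ω⟮I; ℂ, L⟯, s x = 0 ∧
    mfderiv I 𝓘(ℂ, ℂ) (fun y ↦ (trivializationAt ℂ L x ⟨y, s y⟩).2) x v ≠ 0

variable [MeasurableSpace M]

/-- The quantum space `H⁰(M, L)` of global holomorphic sections of `L`, to be equipped with the
inner product `⟪s, t⟫ = ∫ h(s, t) dμ`. -/
def QuantumSpace (_μ : Measure M) : Type _ := Cₛ^ω⟮I; ℂ, L⟯

namespace QuantumSpace

variable {I L} {μ : Measure M}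

instance : AddCommGroup (QuantumSpace I L μ) := inferInstanceAs (AddCommGroup Cₛ^ω⟮I; ℂ, L⟯)

instance : Module ℂ (QuantumSpace I L μ) := inferInstanceAs (Module ℂ Cₛ^ω⟮I; ℂ, L⟯)

instance : DFunLike (QuantumSpace I L μ) M L := inferInstanceAs (DFunLike Cₛ^ω⟮I; ℂ, L⟯ M L)

/-- Evaluation of sections at the point `x`. -/
def eval (x : M) : QuantumSpace I L μ →ₗ[ℂ] L x where
  toFun s := s x
  map_add' _ _ := rfl
  map_smul' _ _ := rfl

variable [ContMDiffVectorBundle ω ℂ L I] [I.Boundaryless] [IsSmoothHermitian I L]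
  [CompactSpace M] [OpensMeasurableSpace M] [IsFiniteMeasure μ]

theorem integrable_inner (s t : QuantumSpace I L μ) :
    Integrable (fun x ↦ inner ℂ (s x) (t x)) μ :=
  (continuous_inner_section (I := I) s t).integrable_of_hasCompactSupport
    (HasCompactSupport.of_compactSpace _)

variable [μ.IsOpenPosMeasure]

/-- The `L²` inner product on holomorphic sections. -/
@[reducible]
def innerCore : InnerProductSpace.Core ℂ (QuantumSpace I L μ) where
  inner s t := ∫ x, inner ℂ (s x) (t x) ∂μ
  conj_inner_symm s t := by
    rw [← integral_conj]
    exact integral_congr_ae (Filter.Eventually.of_forall fun x ↦ inner_conj_symm _ _)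
  re_inner_nonneg s := by
    rw [← integral_re (integrable_inner s s)]
    exact integral_nonneg fun x ↦ inner_self_nonneg
  add_left s t u := by
    rw [← integral_add (integrable_inner s u) (integrable_inner t u)]
    exact integral_congr_ae (Filter.Eventually.of_forall fun x ↦ inner_add_left _ _ _)
  smul_left s t c := by
    rw [← integral_const_mul]
    exact integral_congr_ae (Filter.Eventually.of_forall fun x ↦ inner_smul_left _ _ _)
  definite s hs := by
    have hc : Continuous fun x ↦ (inner ℂ (s x) (s x)).re :=
      Complex.continuous_re.comp (continuous_inner_section (I := I) s s)
    have h0 : ∫ x, (inner ℂ (s x) (s x)).re ∂μ = 0 := by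
      have h := integral_re (𝕜 := ℂ) (integrable_inner s s)
      have h2 := congrArg Complex.re hs
      exact h.trans h2
    have hnn : 0 ≤ fun x ↦ (inner ℂ (s x) (s x)).re := fun x ↦ inner_self_nonneg (𝕜 := ℂ)
    have hae := (integral_eq_zero_iff_of_nonneg hnn (integrable_inner s s).re).1 h0
    have hz := hc.ae_eq_iff_eq μ (continuous_const (y := (0 : ℝ))) |>.1 hae
    refine ContMDiffSection.ext fun x ↦ ?_
    have hx : (inner ℂ (s x) (s x)).re = ‖s x‖ ^ 2 := inner_self_eq_norm_sq (𝕜 := ℂ) (s x)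
    have hx0 : (inner ℂ (s x) (s x)).re = 0 := congrFun hz x
    rw [hx] at hx0
    exact norm_eq_zero.1 (pow_eq_zero_iff two_ne_zero |>.1 hx0)

instance : NormedAddCommGroup (QuantumSpace I L μ) :=
  letI : InnerProductSpace.Core ℂ (QuantumSpace I L μ) := innerCore
  this.toNormedAddCommGroup

instance : InnerProductSpace ℂ (QuantumSpace I L μ) := .ofCore _

theorem inner_def (s t : QuantumSpace I L μ) : inner ℂ s t = ∫ x, inner ℂ (s x) (t x) ∂μ := rfl

instance [IsManifold I ω M] : FiniteDimensional ℂ (QuantumSpace I L μ) :=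
  finiteDimensional_sections (I := I) (L := L)

variable [IsManifold I ω M]

/-- The value `K(x, ·)` of the generalized Bergman kernel `∑ⱼ conj θⱼ(x) ⊗ θⱼ` at `x`, where the
conjugate of the line `L x` is identified with `ℂ` by means of `ℓ ∈ L x`. Here `(θⱼ)` is an
orthonormal basis. -/
def bergmanSection (x : M) (ℓ : L x) : QuantumSpace I L μ :=
  ∑ j, inner ℂ (stdOrthonormalBasis ℂ (QuantumSpace I L μ) j x) ℓ •
    stdOrthonormalBasis ℂ (QuantumSpace I L μ) j

/-- The normalized section `Φ / ‖Φ‖` obtained from the Bergman kernel at `x`. -/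
def coherentVector (x : M) (ℓ : L x) : QuantumSpace I L μ :=
  ((‖(bergmanSection x ℓ : QuantumSpace I L μ)‖ : ℂ)⁻¹) • bergmanSection x ℓ

/-- The vector `v` is a coherent state localized at `x`. The choice of the nonzero `ℓ ∈ L x`
trivializing the fibre only affects the phase of the coherent state. -/
def IsCoherentStateAt (x : M) (v : QuantumSpace I L μ) : Prop :=
  ∃ ℓ : L x, ℓ ≠ 0 ∧ v = coherentVector x ℓ

/-- The coherent state `|x⟩` (with the phase given by the preferred trivialization at `x`). -/
def ket (x : M) : QuantumSpace I L μ :=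
  coherentVector x ((trivializationAt ℂ L x).symm x 1)

/-- The covariant symbol `x ↦ ⟨x|σ|x⟩` of an operator `σ`. -/
def covariantSymbol (σ : QuantumSpace I L μ →ₗ[ℂ] QuantumSpace I L μ) (x : M) : ℂ :=
  inner ℂ (ket x) (σ (ket x))

/-- The zero set of the covariant symbol. -/
def symbolZeroSet (σ : QuantumSpace I L μ →ₗ[ℂ] QuantumSpace I L μ) : Set M :=
  {x | covariantSymbol σ x = 0}

/-- The restriction of holomorphic sections to an arbitrary subset `Λ`. -/
def restriction (Λ : Set M) : QuantumSpace I L μ →ₗ[ℂ] (∀ x : Λ, L x) :=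
  LinearMap.pi fun x ↦ eval x.1

end QuantumSpace

end QuantumSpace

section States

variable {V : Type*} [NormedAddCommGroup V] [InnerProductSpace ℂ V] [FiniteDimensional ℂ V]

/-- A mixed state: a hermitian positive semidefinite operator of trace one. -/
def IsMixedState (σ : V →ₗ[ℂ] V) : Prop :=
  σ.IsPositive ∧ LinearMap.trace ℂ V σ = 1

/-- The operator `Π / tr Π`, where `Π` is the orthogonal projection onto the subspace `K`; it is
the zero operator if `tr Π = 0`. -/
def normalizedProjection (K : Submodule ℂ V) : V →ₗ[ℂ] V :=
  (LinearMap.trace ℂ V K.starProjection.toLinearMap)⁻¹ • K.starProjection.toLinearMap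

end States

section QuantumSpace

variable {E : Type*} [NormedAddCommGroup E] [NormedSpace ℂ E] {H : Type*} [TopologicalSpace H]
  {I : ModelWithCorners ℂ E H} {M : Type*} [TopologicalSpace M] [ChartedSpace H M]
  {L : M → Type*} [∀ x, NormedAddCommGroup (L x)] [∀ x, InnerProductSpace ℂ (L x)]
  [TopologicalSpace (TotalSpace ℂ L)] [FiberBundle ℂ L] [VectorBundle ℂ ℂ L] [MeasurableSpace M]
  {μ : Measure M} [ContMDiffVectorBundle ω ℂ L I] [I.Boundaryless] [IsSmoothHermitian I L]
  [CompactSpace M] [OpensMeasurableSpace M] [IsFiniteMeasure μ] [μ.IsOpenPosMeasure]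
  [IsManifold I ω M]

/-- The state `ρ^ker_Λ` associated to the subset `Λ`: the normalized orthogonal projection onto the
kernel of the restriction map to `Λ`. -/
def kernelState (Λ : Set M) : QuantumSpace I L μ →ₗ[ℂ] QuantumSpace I L μ :=
  normalizedProjection (LinearMap.ker (QuantumSpace.restriction Λ))

end QuantumSpace

section Product

variable {E₁ H₁ E₂ H₂ : Type*} [NormedAddCommGroup E₁] [NormedSpace ℂ E₁] [TopologicalSpace H₁]
  [NormedAddCommGroup E₂] [NormedSpace ℂ E₂] [TopologicalSpace H₂]
  {I₁ : ModelWithCorners ℂ E₁ H₁} {I₂ : ModelWithCorners ℂ E₂ H₂}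
  {M₁ M₂ : Type*} [TopologicalSpace M₁] [TopologicalSpace M₂]
  [ChartedSpace H₁ M₁] [ChartedSpace H₂ M₂] {L₁ : M₁ → Type*} {L₂ : M₂ → Type*}
  [∀ x, NormedAddCommGroup (L₁ x)] [∀ x, InnerProductSpace ℂ (L₁ x)]
  [∀ y, NormedAddCommGroup (L₂ y)] [∀ y, InnerProductSpace ℂ (L₂ y)]
  [TopologicalSpace (TotalSpace ℂ L₁)] [TopologicalSpace (TotalSpace ℂ L₂)]
  [FiberBundle ℂ L₁] [FiberBundle ℂ L₂] [VectorBundle ℂ ℂ L₁] [VectorBundle ℂ ℂ L₂]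

instance instIsSmoothHermitianExtTensor [IsSmoothHermitian I₁ L₁] [IsSmoothHermitian I₂ L₂] :
    IsSmoothHermitian (I₁.prod I₂) (ExtTensor L₁ L₂) := by
  refine ⟨fun x₀ e he ↦ ?_⟩
  obtain ⟨e', ⟨e₁, e₂, h₁, h₂, rfl⟩, rfl⟩ := he.out
  have hs₁ := IsSmoothHermitian.smooth (I := I₁) x₀.1 e₁
  have hs₂ := IsSmoothHermitian.smooth (I := I₂) x₀.2 e₂
  have hmul := (hs₁.comp (s := (extChartAt (I₁.prod I₂) x₀).target ∩
      (extChartAt (I₁.prod I₂) x₀).symm ⁻¹' (e₁.baseSet ×ˢ e₂.baseSet))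
    (contDiff_fst (𝕜 := ℝ) (n := ∞) (E := E₁) (F := E₂)).contDiffOn ?_).mul
    (hs₂.comp (contDiff_snd (𝕜 := ℝ) (n := ∞) (E := E₁) (F := E₂)).contDiffOn ?_)
  · refine hmul.congr fun z hz ↦ ?_
    have hsymm : ∀ p ∈ e₁.baseSet ×ˢ e₂.baseSet,
        ‖(extPretrivialization e₁ e₂).symm p 1‖ ^ 2 =
          ‖e₁.symm p.1 1‖ ^ 2 * ‖e₂.symm p.2 1‖ ^ 2 := by
      intro p hp
      rw [extPretrivialization_symm_apply e₁ e₂ hp, one_smul, ← mul_pow]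
      congr 1
      exact TensorProduct.norm_tmul (𝕜 := ℂ) _ _
    refine (hsymm _ hz.2).trans ?_
    have hsz : (extChartAt (I₁.prod I₂) x₀).symm z =
        ((extChartAt I₁ x₀.1).symm z.1, (extChartAt I₂ x₀.2).symm z.2) := by
      rw [extChartAt_prod]; rfl
    rw [hsz]
    rfl
  · intro z hz
    rw [extChartAt_prod] at hz
    exact ⟨hz.1.1, hz.2.1⟩
  · intro z hz
    rw [extChartAt_prod] at hz
    exact ⟨hz.1.2, hz.2.2⟩

end Product

section Prequantum

variable {d : ℕ} {M : Type*} [TopologicalSpace M] [ChartedSpace (ComplexSpace d) M]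

/-- The `(1,0)`-part `∂f` of the differential of a real function `f`, at the point `z`. -/
def delOperator (f : ComplexSpace d → ℝ) (z u : ComplexSpace d) : ℂ :=
  (1 / 2) * ((fderiv ℝ f z u : ℂ) - Complex.I * (fderiv ℝ f z (Complex.I • u) : ℂ))

/-- The connection form `∂ log ‖e‖²` of the Chern connection of `L`, in the chart at `x₀` and in the
holomorphic frame `e⁻¹(1)` defined by the trivialization `e`. -/
def chernForm {L : M → Type*} [∀ x, NormedAddCommGroup (L x)] [∀ x, InnerProductSpace ℂ (L x)]
    [TopologicalSpace (TotalSpace ℂ L)] (x₀ : M) (e : Trivialization ℂ (π ℂ L))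
    (z u : ComplexSpace d) : ℂ :=
  delOperator
    (fun w ↦ Real.log (‖e.symm ((extChartAt 𝓘(ℂ, ComplexSpace d) x₀).symm w) 1‖ ^ 2)) z u

/-- The curvature of the Chern connection of `L`, the exterior derivative of the
connection form, in the chart at `x₀`. -/
def chernCurvature {L : M → Type*} [∀ x, NormedAddCommGroup (L x)]
    [∀ x, InnerProductSpace ℂ (L x)]
    [TopologicalSpace (TotalSpace ℂ L)] (x₀ : M) (e : Trivialization ℂ (π ℂ L))
    (z u v : ComplexSpace d) : ℂ :=
  fderiv ℝ (fun w ↦ chernForm x₀ e w v) z u - fderiv ℝ (fun w ↦ chernForm x₀ e w u) z v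

/-- The hermitian holomorphic line bundle `L` is a prequantum line bundle for the Kähler form `κ`:
the curvature of its Chern connection is `-i κ`. -/
def IsPrequantum (κ : KahlerForm d M) (L : M → Type*) [∀ x, NormedAddCommGroup (L x)]
    [∀ x, InnerProductSpace ℂ (L x)] [TopologicalSpace (TotalSpace ℂ L)] [FiberBundle ℂ L]
    [VectorBundle ℂ ℂ L] : Prop :=
  ∀ (x₀ : M) (e : Trivialization ℂ (π ℂ L)) [MemTrivializationAtlas e],
    ∀ z ∈ (extChartAt 𝓘(ℂ, ComplexSpace d) x₀).target ∩
      (extChartAt 𝓘(ℂ, ComplexSpace d) x₀).symm ⁻¹' e.baseSet, ∀ u v,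
      chernCurvature x₀ e z u v = -Complex.I * formInChart κ.form x₀ z u v

end Prequantum

section ProductSpace

variable {d₁ d₂ : ℕ} {M₁ M₂ : Type*} [TopologicalSpace M₁] [TopologicalSpace M₂]
  [SecondCountableTopology M₁] [SecondCountableTopology M₂] [CompactSpace M₁] [CompactSpace M₂]
  [ChartedSpace (ComplexSpace d₁) M₁] [ChartedSpace (ComplexSpace d₂) M₂]
  [IsManifold 𝓘(ℂ, ComplexSpace d₁) ω M₁] [IsManifold 𝓘(ℂ, ComplexSpace d₂) ω M₂]
  [MeasurableSpace M₁] [MeasurableSpace M₂] [BorelSpace M₁] [BorelSpace M₂]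
  (κ₁ : KahlerForm d₁ M₁) (κ₂ : KahlerForm d₂ M₂) (L₁ : M₁ → Type*) (L₂ : M₂ → Type*)
  [∀ x, NormedAddCommGroup (L₁ x)] [∀ x, InnerProductSpace ℂ (L₁ x)]
  [∀ y, NormedAddCommGroup (L₂ y)] [∀ y, InnerProductSpace ℂ (L₂ y)]
  [TopologicalSpace (TotalSpace ℂ L₁)] [TopologicalSpace (TotalSpace ℂ L₂)]
  [FiberBundle ℂ L₁] [FiberBundle ℂ L₂] [VectorBundle ℂ ℂ L₁] [VectorBundle ℂ ℂ L₂]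
  [ContMDiffVectorBundle ω ℂ L₁ 𝓘(ℂ, ComplexSpace d₁)]
  [ContMDiffVectorBundle ω ℂ L₂ 𝓘(ℂ, ComplexSpace d₂)]
  [IsSmoothHermitian 𝓘(ℂ, ComplexSpace d₁) L₁] [IsSmoothHermitian 𝓘(ℂ, ComplexSpace d₂) L₂]

/-- The quantum Hilbert space `H⁰(M₁ × M₂, L₁ ⊠ L₂)`, with the `L²` inner product given by the
product hermitian metric and the product measure, which is the measure associated
to `ω₁^d₁ ω₂^d₂ / (d₁! d₂!)`. -/
abbrev ProductQuantumSpace : Type _ :=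
  QuantumSpace (𝓘(ℂ, ComplexSpace d₁).prod 𝓘(ℂ, ComplexSpace d₂)) (ExtTensor L₁ L₂)
    (κ₁.volumeMeasure.prod κ₂.volumeMeasure)

variable {κ₁ κ₂ L₁ L₂}

/-- The section `s₁ ⊠ s₂ : (x, y) ↦ s₁(x) ⊗ s₂(y)`. -/
def boxTensor (s₁ : QuantumSpace 𝓘(ℂ, ComplexSpace d₁) L₁ κ₁.volumeMeasure)
    (s₂ : QuantumSpace 𝓘(ℂ, ComplexSpace d₂) L₂ κ₂.volumeMeasure) :
    ProductQuantumSpace κ₁ κ₂ L₁ L₂ where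
  toFun p := pureTensor (s₁ p.1) (s₂ p.2)
  contMDiff_toFun := by
    intro p
    rw [contMDiffAt_section]
    let e₁ := trivializationAt ℂ L₁ p.1
    let e₂ := trivializationAt ℂ L₂ p.2
    have h₁ : ContMDiffAt 𝓘(ℂ, ComplexSpace d₁) 𝓘(ℂ, ℂ) ω (fun x ↦ (e₁ ⟨x, s₁ x⟩).2) p.1 :=
      (e₁.contMDiffAt_section_iff (mem_baseSet_trivializationAt ℂ L₁ p.1)).1
        (ContMDiffSection.contMDiff s₁ p.1)
    have h₂ : ContMDiffAt 𝓘(ℂ, ComplexSpace d₂) 𝓘(ℂ, ℂ) ω (fun x ↦ (e₂ ⟨x, s₂ x⟩).2) p.2 :=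
      (e₂.contMDiffAt_section_iff (mem_baseSet_trivializationAt ℂ L₂ p.2)).1
        (ContMDiffSection.contMDiff s₂ p.2)
    have hm := (h₁.comp p contMDiffAt_fst).mul (h₂.comp p contMDiffAt_snd)
    refine hm.congr_of_eventuallyEq ?_
    have hnb : e₁.baseSet ×ˢ e₂.baseSet ∈ 𝓝 p := (e₁.open_baseSet.prod e₂.open_baseSet).mem_nhds
      ⟨mem_baseSet_trivializationAt ℂ L₁ p.1, mem_baseSet_trivializationAt ℂ L₂ p.2⟩
    filter_upwards [hnb] with q hq
    change (TensorProduct.lid ℂ ℂ) (TensorProduct.map (e₁.linearMapAt ℂ q.1)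
      (e₂.linearMapAt ℂ q.2) (s₁ q.1 ⊗ₜ[ℂ] s₂ q.2)) = (e₁ ⟨q.1, s₁ q.1⟩).2 * (e₂ ⟨q.2, s₂ q.2⟩).2
    rw [TensorProduct.map_tmul, TensorProduct.lid_tmul, smul_eq_mul, e₁.linearMapAt_apply,
      e₂.linearMapAt_apply, if_pos hq.1, if_pos hq.2]

/-- Under `H⁰(M₁, L₁) ⊗ H⁰(M₂, L₂) ≅ H⁰(M₁ × M₂, L₁ ⊠ L₂)`, the inner product is the one of the
tensor product of Hilbert spaces. -/
theorem inner_boxTensor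
    (s₁ t₁ : QuantumSpace 𝓘(ℂ, ComplexSpace d₁) L₁ κ₁.volumeMeasure)
    (s₂ t₂ : QuantumSpace 𝓘(ℂ, ComplexSpace d₂) L₂ κ₂.volumeMeasure) :
    inner ℂ (boxTensor s₁ s₂) (boxTensor t₁ t₂) = inner ℂ s₁ t₁ * inner ℂ s₂ t₂ := by
  rw [QuantumSpace.inner_def, QuantumSpace.inner_def, QuantumSpace.inner_def,
    ← integral_prod_mul]
  refine integral_congr_ae (Filter.Eventually.of_forall fun p ↦ ?_)
  exact TensorProduct.inner_tmul (𝕜 := ℂ) _ _ _ _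

end ProductSpace

end KahlerQuantization

end

open KahlerQuantization

/-! The statement rests on a duality between subspaces of sections and subsets of the manifold, in
which coherent states play the role of points. By the reproducing property of the Bergman kernel
(`inner_bergmanSection`), pairing a section `s` with the kernel at `x` returns the value `s x` read
against a vector of the fibre. Since the fibre is a line, a coherent state at `x` is orthogonal to
`s` exactly when `s x = 0` (`IsCoherentStateAt.inner_eq_zero_iff`). Orthogonality to a coherent
state thus depends only on its point and not on its phase.

Let `σ` be the normalized projection onto `K`. Up to the nonzero factor `1 / tr Π`, its symbol at
`x` is the squared norm of the projection of `ket x` to `K`. It vanishes exactly when `ket x` lies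
in `Kᗮ`, that is, when every section in `K` vanishes at `x`. So `𝒱(σ)` is the common zero set of `K`
(`mem_symbolZeroSet_normalizedProjection`), and `K` is contained in the space of sections vanishing
on it.

The reverse inclusion may fail for a general `K`; the coherent states in `Kᗮ` supply it
(`ker_restriction_symbolZeroSet`). Each member of the spanning family is a coherent state at some
`x` and lies in `Kᗮ`, so `x` belongs to `𝒱(σ)`. A section `s` vanishing on `𝒱(σ)` then vanishes at
all these points, hence is orthogonal to a spanning set of `Kᗮ`, and `s ∈ Kᗮᗮ = K`. -/

namespace KahlerQuantization

/-! ### Normalized orthogonal projections: range and null vectors of the quadratic form. -/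

section NormalizedProjection

variable {V : Type*} [NormedAddCommGroup V] [InnerProductSpace ℂ V] [FiniteDimensional ℂ V]

/-- With the convention `0⁻¹ = 0`, a zero trace would make the normalized projection the zero
operator. Nonvanishing of the operator is therefore the convenient form of nondegeneracy: it follows
at once from trace one and provides the invertible scalar used below. -/
theorem trace_starProjection_ne_zero {K : Submodule ℂ V} (h : normalizedProjection K ≠ 0) :
    LinearMap.trace ℂ V K.starProjection.toLinearMap ≠ 0 := by
  intro h0
  exact h (by rw [normalizedProjection, h0, inv_zero, zero_smul])

/-- A nonzero scalar does not change the range of the projection. This links `Ran(σ)ᗮ`, where the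
coherent basis lives, to `Kᗮ`, where the argument takes place. -/
theorem range_normalizedProjection {K : Submodule ℂ V} (h : normalizedProjection K ≠ 0) :
    LinearMap.range (normalizedProjection K) = K := by
  rw [normalizedProjection, LinearMap.range_smul _ _ (inv_ne_zero (trace_starProjection_ne_zero h))]
  exact K.range_starProjection

/-- A projection is self-adjoint and idempotent, so `⟪v, Π v⟫ = ⟪Π v, Π v⟫`, which is zero only if
`Π v = 0`; the kernel of `Π` is `Kᗮ`. Applied to `v = ket x`, this describes the zeros of the
covariant symbol. -/
theorem inner_normalizedProjection_self_eq_zero {K : Submodule ℂ V}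
    (h : normalizedProjection K ≠ 0) (v : V) :
    inner ℂ v (normalizedProjection K v) = 0 ↔ v ∈ Kᗮ := by
  have hc := inv_ne_zero (trace_starProjection_ne_zero h)
  have happ : normalizedProjection K v =
      (LinearMap.trace ℂ V K.starProjection.toLinearMap)⁻¹ • K.starProjection v := rfl
  have hself : inner ℂ v (K.starProjection v) =
      inner ℂ (K.starProjection v) (K.starProjection v) := by
    rw [K.inner_starProjection_left_eq_right,
      Submodule.starProjection_eq_self_iff.2 (K.starProjection_apply_mem v)]
  rw [happ, inner_smul_right, mul_eq_zero, or_iff_right hc, hself, inner_self_eq_zero,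
    Submodule.starProjection_apply_eq_zero_iff]

end NormalizedProjection

/-! ### Coherent states as evaluation functionals, and the zero set of the symbol. -/

namespace QuantumSpace

variable {E : Type*} [NormedAddCommGroup E] [NormedSpace ℂ E] {H : Type*} [TopologicalSpace H]
  {I : ModelWithCorners ℂ E H} {M : Type*} [TopologicalSpace M] [ChartedSpace H M]
  {L : M → Type*} [∀ x, NormedAddCommGroup (L x)] [∀ x, InnerProductSpace ℂ (L x)]
  [TopologicalSpace (TotalSpace ℂ L)] [FiberBundle ℂ L] [VectorBundle ℂ ℂ L] [MeasurableSpace M]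
  {μ : Measure M} [ContMDiffVectorBundle ω ℂ L I] [I.Boundaryless] [IsSmoothHermitian I L]
  [CompactSpace M] [OpensMeasurableSpace M] [IsFiniteMeasure μ] [μ.IsOpenPosMeasure]
  [IsManifold I ω M]

/-- The reproducing property of the Bergman kernel. -/
theorem inner_bergmanSection (x : M) (ℓ : L x) (s : QuantumSpace I L μ) :
    inner ℂ (bergmanSection x ℓ) s = inner ℂ ℓ (s x) := by
  let θ := stdOrthonormalBasis ℂ (QuantumSpace I L μ)
  -- Evaluation at `x` is linear, so the orthonormal expansion of `s` can be evaluated term by term.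
  -- Both sides of the goal then become the sum of `⟪ℓ, θ j x⟫ * ⟪θ j, s⟫`; on the left, the
  -- conjugate-linear first slot turns the coefficient `⟪θ j x, ℓ⟫` into `⟪ℓ, θ j x⟫`.
  have hs : s x = ∑ j, inner ℂ (θ j) s • θ j x := by
    have h := congrArg (eval x) (θ.sum_repr' s)
    simp only [map_sum, map_smul] at h
    exact h.symm
  rw [hs, bergmanSection, sum_inner, inner_sum]
  refine Finset.sum_congr rfl fun j _ ↦ ?_
  rw [inner_smul_left, inner_smul_right, inner_conj_symm, mul_comm]

/-- In a line, a vector orthogonal to a nonzero vector vanishes. -/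
theorem inner_fibre_eq_zero {x : M} {ℓ : L x} (hℓ : ℓ ≠ 0) (u : L x) :
    inner ℂ ℓ u = 0 ↔ u = 0 := by
  refine ⟨fun h ↦ ?_, fun h ↦ by rw [h, inner_zero_right]⟩
  -- The rank-one property enters through a local frame: `ℓ` and `u` are multiples `a` and `c` of
  -- the same nonzero vector `f`, so their inner product is `conj a * c * ‖f‖²`, with `a ≠ 0`.
  let e := trivializationAt ℂ L x
  have hx : x ∈ e.baseSet := mem_baseSet_trivializationAt ℂ L x
  have hℓe := eq_smul_frame e hx ℓ
  have hue := eq_smul_frame e hx u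
  have ha : (e ⟨x, ℓ⟩).2 ≠ 0 := fun h0 ↦ hℓ (by rw [← hℓe, h0, zero_smul])
  have hf := frame_ne_zero e hx
  rw [← hℓe, ← hue, inner_smul_left, inner_smul_right] at h
  have hc : (e ⟨x, u⟩).2 = 0 := by
    simpa [ha, hf] using h
  rw [← hue, hc, zero_smul]

/-- The reproducing property turns the pairing with the unnormalized section into `⟪ℓ, s x⟫`, whose
vanishing in a line means `s x = 0`. The normalizing factor then has to be removed. -/
theorem inner_coherentVector_eq_zero {x : M} {ℓ : L x} (hℓ : ℓ ≠ 0) (s : QuantumSpace I L μ) :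
    inner ℂ (coherentVector x ℓ) s = 0 ↔ s x = 0 := by
  rw [← inner_fibre_eq_zero hℓ, ← inner_bergmanSection, coherentVector, inner_smul_left,
    mul_eq_zero, or_iff_right_iff_imp]
  -- Here the normalizing factor is zero, which by `0⁻¹ = 0` happens only if the Bergman section
  -- itself is zero. The pairing with `s` is then zero as well, so the equivalence persists in this
  -- degenerate case.
  intro h
  have hΦ : (bergmanSection x ℓ : QuantumSpace I L μ) = 0 := by simpa using h
  rw [hΦ, inner_zero_left]

theorem IsCoherentStateAt.inner_eq_zero_iff {x : M} {v : QuantumSpace I L μ}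
    (hv : IsCoherentStateAt x v) (s : QuantumSpace I L μ) : inner ℂ v s = 0 ↔ s x = 0 := by
  obtain ⟨ℓ, hℓ, rfl⟩ := hv
  exact inner_coherentVector_eq_zero hℓ s

/-- The preferred frame is one admissible nonzero `ℓ`. Hence the vectors `ket x` defining the symbol
and the coherent states of the given basis, whose phases may differ, obey the same orthogonality
criterion. -/
theorem isCoherentStateAt_ket (x : M) : IsCoherentStateAt x (ket x : QuantumSpace I L μ) :=
  ⟨_, frame_ne_zero _ (mem_baseSet_trivializationAt ℂ L x), rfl⟩

/-- The dictionary between Hilbert space and geometry. It is used in both directions: for `ket x`,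
to identify the zero set of the symbol, and for the spanning vectors of `Kᗮ`, to place their points
in that set. -/
theorem IsCoherentStateAt.mem_orthogonal_iff {x : M} {v : QuantumSpace I L μ}
    (hv : IsCoherentStateAt x v) (K : Submodule ℂ (QuantumSpace I L μ)) :
    v ∈ Kᗮ ↔ ∀ s ∈ K, s x = 0 := by
  rw [Submodule.mem_orthogonal']
  exact forall₂_congr fun s _ ↦ hv.inner_eq_zero_iff s

/-- The zero set of the symbol of a normalized projection is the common zero set of the sections in
the subspace. -/
theorem mem_symbolZeroSet_normalizedProjection {K : Submodule ℂ (QuantumSpace I L μ)}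
    (hK : normalizedProjection K ≠ 0) (x : M) :
    x ∈ symbolZeroSet (normalizedProjection K) ↔ ∀ s ∈ K, s x = 0 :=
  (inner_normalizedProjection_self_eq_zero hK _).trans
    ((isCoherentStateAt_ket x).mem_orthogonal_iff K)

theorem mem_ker_restriction (Λ : Set M) (s : QuantumSpace I L μ) :
    s ∈ LinearMap.ker (restriction Λ) ↔ ∀ x ∈ Λ, s x = 0 := by
  rw [LinearMap.mem_ker, funext_iff]
  exact Subtype.forall

/-- A subspace whose orthogonal complement is spanned by coherent states consists of all sections
which vanish on its common zero set. -/
theorem ker_restriction_symbolZeroSet {K : Submodule ℂ (QuantumSpace I L μ)}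
    (hK : normalizedProjection K ≠ 0) {ι : Type*} (b : ι → QuantumSpace I L μ)
    (hspan : Submodule.span ℂ (range b) = Kᗮ) (hb : ∀ i, ∃ x, IsCoherentStateAt x (b i)) :
    LinearMap.ker (restriction (symbolZeroSet (normalizedProjection K))) = K := by
  refine le_antisymm (fun s hs ↦ ?_) fun s hs ↦ ?_
  · rw [mem_ker_restriction] at hs
    -- In finite dimension `K = Kᗮᗮ`, so membership of `s` in `K` can be tested against the span of
    -- the coherent states.
    rw [← K.orthogonal_orthogonal, ← hspan, Submodule.mem_orthogonal]
    intro v hv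
    induction hv using Submodule.span_induction with
    | mem v hv =>
      obtain ⟨i, rfl⟩ := hv
      obtain ⟨x, hx⟩ := hb i
      refine (hx.inner_eq_zero_iff s).2 (hs x ?_)
      -- The point `x` lies in the zero set because its coherent state `b i` is itself in `Kᗮ`: this
      -- is where the hypothesis on `Kᗮ` acts.
      rw [mem_symbolZeroSet_normalizedProjection hK, ← hx.mem_orthogonal_iff, ← hspan]
      exact Submodule.subset_span ⟨i, rfl⟩
    | zero => exact inner_zero_left _
    | add v w _ _ hv hw => rw [inner_add_left, hv, hw, add_zero]
    | smul c v _ hv => rw [inner_smul_left, hv, mul_zero]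
  · rw [mem_ker_restriction]
    exact fun x hx ↦ (mem_symbolZeroSet_normalizedProjection hK x).1 hx s hs

end QuantumSpace

end KahlerQuantization

/-! ### The theorem on the product manifold. -/

theorem theorem4p2 {d₁ d₂ : ℕ} (hd₁ : 1 ≤ d₁) (hd₂ : 1 ≤ d₂) {M₁ M₂ : Type*}
    -- compact connected complex manifolds
    [TopologicalSpace M₁] [T2Space M₁] [SecondCountableTopology M₁] [CompactSpace M₁]
    [ConnectedSpace M₁] [ChartedSpace (ComplexSpace d₁) M₁]
    [IsManifold 𝓘(ℂ, ComplexSpace d₁) ω M₁] [MeasurableSpace M₁] [BorelSpace M₁]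
    [TopologicalSpace M₂] [T2Space M₂] [SecondCountableTopology M₂] [CompactSpace M₂]
    [ConnectedSpace M₂] [ChartedSpace (ComplexSpace d₂) M₂]
    [IsManifold 𝓘(ℂ, ComplexSpace d₂) ω M₂] [MeasurableSpace M₂] [BorelSpace M₂]
    -- Kähler forms
    (κ₁ : KahlerForm d₁ M₁) (κ₂ : KahlerForm d₂ M₂)
    -- holomorphic hermitian line bundles
    {L₁ : M₁ → Type*} [∀ x, NormedAddCommGroup (L₁ x)] [∀ x, InnerProductSpace ℂ (L₁ x)]
    [TopologicalSpace (Bundle.TotalSpace ℂ L₁)] [FiberBundle ℂ L₁] [VectorBundle ℂ ℂ L₁]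
    [ContMDiffVectorBundle ω ℂ L₁ 𝓘(ℂ, ComplexSpace d₁)]
    [IsSmoothHermitian 𝓘(ℂ, ComplexSpace d₁) L₁]
    {L₂ : M₂ → Type*} [∀ y, NormedAddCommGroup (L₂ y)] [∀ y, InnerProductSpace ℂ (L₂ y)]
    [TopologicalSpace (Bundle.TotalSpace ℂ L₂)] [FiberBundle ℂ L₂] [VectorBundle ℂ ℂ L₂]
    [ContMDiffVectorBundle ω ℂ L₂ 𝓘(ℂ, ComplexSpace d₂)]
    [IsSmoothHermitian 𝓘(ℂ, ComplexSpace d₂) L₂]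
    -- very ample prequantum line bundles
    (hL₁ : IsPrequantum κ₁ L₁) (hL₂ : IsPrequantum κ₂ L₂)
    (hA₁ : IsVeryAmple 𝓘(ℂ, ComplexSpace d₁) L₁) (hA₂ : IsVeryAmple 𝓘(ℂ, ComplexSpace d₂) L₂)
    -- a mixed state which is a normalized orthogonal projection
    (σ : ProductQuantumSpace κ₁ κ₂ L₁ L₂ →ₗ[ℂ] ProductQuantumSpace κ₁ κ₂ L₁ L₂)
    (hσ : IsMixedState σ)
    (hproj : ∃ K : Submodule ℂ (ProductQuantumSpace κ₁ κ₂ L₁ L₂), σ = normalizedProjection K)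
    -- a basis of the orthogonal complement of its range, consisting of coherent states
    {ι : Type*} (b : Module.Basis ι ℂ ↥(LinearMap.range σ)ᗮ)
    (hb : ∀ i, ∃ x : M₁ × M₂,
      QuantumSpace.IsCoherentStateAt x (b i : ProductQuantumSpace κ₁ κ₂ L₁ L₂)) :
    kernelState (QuantumSpace.symbolZeroSet σ) = σ := by
  obtain ⟨K, rfl⟩ := hproj
  -- Trace one excludes the zero operator, and with it the degenerate branch of the normalization.
  have hK : normalizedProjection K ≠ 0 := by
    intro h
    have := hσ.2
    rw [h, map_zero] at this
    exact zero_ne_one this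
  have hspan : Submodule.span ℂ (Set.range fun i ↦ (b i : ProductQuantumSpace κ₁ κ₂ L₁ L₂)) =
      Kᗮ := by
    -- The vectors `b i` span the subspace regarded as a space of its own; pushing this equality
    -- through the inclusion gives the span in the ambient space.
    have h := congrArg (Submodule.map (LinearMap.range (normalizedProjection K))ᗮ.subtype) b.span_eq
    rw [Submodule.map_span, ← Set.range_comp, Submodule.map_subtype_top] at h
    exact h.trans (congrArg _ (range_normalizedProjection hK))
  -- Both states are normalized projections, each determined by its subspace, so equality of the two
  -- subspaces suffices.
  rw [kernelState, QuantumSpace.ker_restriction_symbolZeroSet hK _ hspan hb]
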